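/- Let $d\ge 2$, let $\Omega\subset\mathbb R^d$ be a bounded Lipschitz domain, $T>0$, $\nu\ge 0$. Let $C^\infty_{c,\sigma}(\Omega)$ be the smooth divergence-free vector fields with compact support in $\Omega$, and let $L^2_\sigma(\Omega)$, $H^1_{0,\sigma}(\Omega)$ be its closures in $L^2(\Omega)$, $H^1(\Omega)$. Put $\mathbb X=L^\infty(0,T;L^2_\sigma(\Omega))\cap L^2(0,T;H^1_{0,\sigma}(\Omega))$ and $\mathbb Y=\mathbb X\cap L^2(0,T;H^2(\Omega))\cap L^1(0,T;W^{1,\infty}(\Omega))\cap H^1(0,T;L^2_\sigma(\Omega)^*)$ if $\nu>0$, and $\mathbb X=L^\infty(0,T;L^2_\sigma(\Omega))$, $\mathbb Y=\mathbb X\cap L^1(0,T;W^{1,\infty}(\Omega))\cap H^1(0,T;L^2_\sigma(\Omega)^*)$ if $\nu=0$. Let $f\in L^2(0,T;H^{-1}(\Omega))+L^1(0,T;L^2(\Omega))$ if $\nu>0$, $f\in L^1(0,T;L^2(\Omega))$ if $\nu=0$, and $v_0\in L^2_\sigma(\Omega)$. Write $(\cdot,\cdot)$ for $L^2$ inner products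 (Frobenius for matrix fields), $(\nabla w)_{ij}=\partial_j w_i$, $A_{\rm sym}=\frac12(A+A^T)$, $\mathcal R(v|w)=\frac12\|v-w\|_{L^2(\Omega)}^2$ and, for $w\in\mathbb Y$, $$\langle\mathcal A_\nu(w),z\rangle=\langle\partial_t w,z\rangle+((w\cdot\nabla)w,z)+\nu(\nabla w,\nabla z)-\langle f,z\rangle .$$ For $K:L^2_\sigma(\Omega)\to[0,\infty]$ let $\mathcal D(K)=\{w\in\mathbb X: K(w)\in L^1(0,T)\}$ and $$\mathcal W_\nu(v|w)=\nu\|\nabla v-\nabla w\|_{L^2(\Omega)}^2-(((v-w)\cdot\nabla)(v-w),w)+K(w)\mathcal R(v|w)\quad(\nu>0),$$ $$\mathcal W_0(v|w)=\int_\Omega (v-w)^T(\nabla w)_{\rm sym}(v-w)\,dx+K(w)\mathcal R(v|w)\quad(\nu=0).$$ $K$ is called admissible if $K(0)=0$, there is a topology on $\mathcal D(K)$ for which $K:\mathcal D(K)\to L^1(0,T)$ is continuous and $C^1([0,T];C^\infty_{c,\sigma}(\Omega))\subset\mathcal D(K)$ is dense, and $\mathcal W_\nu(v|w)\ge0$ a.e.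 in $(0,T)$ for all $v\in\mathbb X$, $w\in\mathbb Y\cap\mathcal D(K)$. A pair $(v,\xi)\in\mathbb X\times L^\infty(0,T)$ is an energy-variational solution if $\xi\ge0$ on $(0,T)$, the initial value $v(0)=v_0$ is attained in the weak sense (weakly in $L^2_\sigma(\Omega)$ as $t\searrow0$), and for every admissible $K$, every $w\in\mathbb Y\cap\mathcal D(K)$ and a.e. $s<t$ in $(0,T)$ $$\mathcal R(v(t)|w(t))+\xi(t)+\int_s^t\Big(\mathcal W_\nu(v|w)+\langle\mathcal A_\nu(w),v-w\rangle-K(w)\big(\mathcal R(v|w)+\xi\big)\Big)d\tau\le\mathcal R(v(s)|w(s))+\xi(s).$$ **Proposition.** Let $(v,\xi)$ be an energy-variational solution, and let $K$ be an admissible form that is homogeneous of degree one, i.e. $K(\alpha u)=|\alpha|K(u)$ for all $\alpha\in\mathbb R$, $u\in L^2_\sigma(\Omega)$. Then for all $0<s<t<T$ the following holds, all integrands below being integrable. With $E=\frac12\|v\|_{L^2(\Omega)}^2+\xi$, $$E(r)-E(q)+\int_q^r\big(\nu\|\nabla v\|_{L^2(\Omega)}^2-\langle f,v\rangle\big)\,d\tau\le0\qquad\text{for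 a.e. } q<r \text{ in } (s,t),$$ and, for all $\tilde v\in C^1_c((s,t);C^\infty_{c,\sigma}(\Omega))\cap\mathcal D(K)$ (extended by zero to $(0,T)$), $$\Big|\int_s^t\Big(\nu(\nabla v,\nabla\tilde v)-(v\otimes v;\nabla\tilde v)-(v,\partial_t\tilde v)-\langle f,\tilde v\rangle\Big)\,d\tau\Big|\le\int_s^t K(\tilde v)\,\xi\,d\tau .$$ -/

import Mathlib

open MeasureTheory Filter Topology
open scoped ENNReal ContDiff

noncomputable section

namespace EVS

/-- Vectors of `ℝ^d` with the Euclidean norm. -/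
abbrev Vec (d : ℕ) := EuclideanSpace ℝ (Fin d)

/-- `d × d` matrices with the Frobenius norm; the entry `(i, j)` of a gradient is `∂ⱼ uᵢ`. -/
abbrev Mat (d : ℕ) := EuclideanSpace ℝ (Fin d × Fin d)

/-- A bounded Lipschitz domain: bounded, open, connected, and near each boundary point the set
of points above the graph of a Lipschitz function over a hyperplane `nᗮ`, `|n| = 1`. -/
structure IsBoundedLipschitzDomain {d : ℕ} (Ω : Set (Vec d)) : Prop where
  isOpen : IsOpen Ω
  isConnected : IsConnected Ω
  isBounded : Bornology.IsBounded Ω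
  lipschitz_boundary : ∀ p ∈ frontier Ω, ∃ r > (0 : ℝ), ∃ n : Vec d, ‖n‖ = 1 ∧
    ∃ (L : NNReal) (γ : Vec d → ℝ), LipschitzWith L γ ∧
      Ω ∩ Metric.ball p r =
        {x | γ (x - (inner ℝ n x) • n) < inner ℝ n x} ∩ Metric.ball p r

/-! ### Test functions -/

/-- `φ ∈ C_c^∞(U; F)`, extended by zero to the whole space. -/
def IsTest {X F : Type*} [NormedAddCommGroup X] [NormedSpace ℝ X]
    [NormedAddCommGroup F] [NormedSpace ℝ F] (U : Set X) (φ : X → F) : Prop :=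
  ContDiff ℝ ∞ φ ∧ HasCompactSupport φ ∧ tsupport φ ⊆ U

/-- The classical gradient of a vector field. -/
def gradMat {d : ℕ} (φ : Vec d → Vec d) (x : Vec d) : Mat d :=
  WithLp.toLp 2 fun p => fderiv ℝ φ x (EuclideanSpace.single p.2 1) p.1

/-- The classical divergence of a vector field. -/
def divergence {d : ℕ} (φ : Vec d → Vec d) (x : Vec d) : ℝ :=
  ∑ i, fderiv ℝ φ x (EuclideanSpace.single i 1) i

/-- `φ ∈ C_{c,σ}^∞(Ω; ℝ^d)`: smooth solenoidal fields with compact support in `Ω`. -/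
def IsSolTest {d : ℕ} (Ω : Set (Vec d)) (φ : Vec d → Vec d) : Prop :=
  IsTest Ω φ ∧ ∀ x, divergence φ x = 0

/-- `φ ∈ C¹(ℝ; C_{c,σ}^∞(Ω; ℝ^d))`: the supports lie in one compact subset of `Ω`, and `φ` and
`∂ₜφ` have spatial derivatives of every order that are jointly continuous in time and space. -/
structure IsC1Test {d : ℕ} (Ω : Set (Vec d)) (φ : ℝ → Vec d → Vec d) : Prop where
  support : ∃ C : Set (Vec d), IsCompact C ∧ C ⊆ Ω ∧ ∀ t, ∀ x ∉ C, φ t x = 0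
  smooth : ∀ t, ContDiff ℝ ∞ (φ t)
  solenoidal : ∀ t x, divergence (φ t) x = 0
  differentiable : ∀ x, Differentiable ℝ fun t => φ t x
  smooth_deriv : ∀ t, ContDiff ℝ ∞ fun x => deriv (fun τ => φ τ x) t
  continuous : ∀ n : ℕ, Continuous fun p : ℝ × Vec d => iteratedFDeriv ℝ n (φ p.1) p.2
  continuous_deriv : ∀ n : ℕ, Continuous fun p : ℝ × Vec d =>
    iteratedFDeriv ℝ n (fun x => deriv (fun τ => φ τ x) p.1) p.2

/-- `φ ∈ C¹_c((s,t); C_{c,σ}^∞(Ω; ℝ^d))`, extended by zero. -/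
def IsC1cTest {d : ℕ} (Ω : Set (Vec d)) (s t : ℝ) (φ : ℝ → Vec d → Vec d) : Prop :=
  IsC1Test Ω φ ∧ ∃ a b, s < a ∧ a ≤ b ∧ b < t ∧ ∀ τ ∉ Set.Icc a b, ∀ x, φ τ x = 0

/-! ### Function spaces on `Ω` -/

/-- `L^p(Ω; ℝ^ι)`. -/
abbrev LpOn {d : ℕ} (Ω : Set (Vec d)) (ι : Type) [Fintype ι] (p : ℝ≥0∞) :=
  Lp (EuclideanSpace ℝ ι) p (volume.restrict Ω)

/-- `L²(Ω; ℝ^d)`. -/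
abbrev L2 {d : ℕ} (Ω : Set (Vec d)) := LpOn Ω (Fin d) 2

/-- `L²(Ω; ℝ^{d×d})`. -/
abbrev L2Mat {d : ℕ} (Ω : Set (Vec d)) := LpOn Ω (Fin d × Fin d) 2

/-- `L²_σ(Ω)`: the closure of `C_{c,σ}^∞(Ω; ℝ^d)` in `L²(Ω)`. -/
def L2sigma {d : ℕ} (Ω : Set (Vec d)) : Submodule ℝ (L2 Ω) :=
  (Submodule.span ℝ {u : L2 Ω | ∃ φ, IsSolTest Ω φ ∧ u =ᵐ[volume.restrict Ω] φ}).topologicalClosure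

/-- The closure of a set `A` of smooth compactly supported fields with respect to the norm
`(‖u‖² + ‖∇u‖²)^{1/2}` of `H¹(Ω)`; an element is recorded as the pair `(u, ∇u)`. -/
def H1closure {d : ℕ} (Ω : Set (Vec d)) (A : Set (Vec d → Vec d)) :
    Submodule ℝ (WithLp 2 (L2 Ω × L2Mat Ω)) :=
  (Submodule.span ℝ {p : WithLp 2 (L2 Ω × L2Mat Ω) | ∃ φ ∈ A,
    p.fst =ᵐ[volume.restrict Ω] φ ∧ p.snd =ᵐ[volume.restrict Ω] gradMat φ}).topologicalClosure

/-- `H¹_0(Ω; ℝ^d)`, as the space of pairs `(u, ∇u)`. -/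
def H10 {d : ℕ} (Ω : Set (Vec d)) : Submodule ℝ (WithLp 2 (L2 Ω × L2Mat Ω)) :=
  H1closure Ω {φ | IsTest Ω φ}

/-- `H¹_{0,σ}(Ω)`, as the space of pairs `(u, ∇u)`. -/
def H10sigma {d : ℕ} (Ω : Set (Vec d)) : Submodule ℝ (WithLp 2 (L2 Ω × L2Mat Ω)) :=
  H1closure Ω {φ | IsSolTest Ω φ}

/-- `G` is the weak gradient of `u` in `Ω`. -/
def IsWeakGrad {d : ℕ} (Ω : Set (Vec d)) {ι : Type} [Fintype ι]
    (u : Vec d → EuclideanSpace ℝ ι) (G : Vec d → EuclideanSpace ℝ (ι × Fin d)) : Prop :=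
  ∀ η : Vec d → ℝ, IsTest Ω η → ∀ (i : ι) (j : Fin d),
    ∫ x in Ω, u x i * fderiv ℝ η x (EuclideanSpace.single j 1) = -∫ x in Ω, G x (i, j) * η x

open Classical in
/-- The weak gradient of `u ∈ L²(Ω; ℝ^d)` if there is one in `L²` (it is then unique), else `0`. -/
def weakGrad {d : ℕ} {Ω : Set (Vec d)} (u : L2 Ω) : L2Mat Ω :=
  if h : ∃ G : L2Mat Ω, IsWeakGrad Ω u G then h.choose else 0

/-! ### Function spaces in time -/

/-- Lebesgue measure on `(0,T)`. -/
def timeMeasure (T : ℝ) : Measure ℝ := volume.restrict (Set.Ioo 0 T)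

/-- `v ∈ 𝕏`: `v ∈ L^∞(0,T; L²_σ(Ω))` and, if `ν > 0`, also `v ∈ L²(0,T; H¹_{0,σ}(Ω))`. -/
def MemX {d : ℕ} {Ω : Set (Vec d)} (ν T : ℝ) (v : ℝ → L2sigma Ω) : Prop :=
  MemLp v ⊤ (timeMeasure T) ∧
  (0 < ν → ∃ G : ℝ → L2Mat Ω, MemLp G 2 (timeMeasure T) ∧
    ∀ᵐ t ∂timeMeasure T, WithLp.toLp 2 ((v t : L2 Ω), G t) ∈ H10sigma Ω)

/-- `w ∈ L¹(0,T; W^{1,∞}(Ω))`. -/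
def MemL1W1inf {d : ℕ} {Ω : Set (Vec d)} (T : ℝ) (w : ℝ → L2sigma Ω) : Prop :=
  ∃ (U : ℝ → LpOn Ω (Fin d) ⊤) (G : ℝ → LpOn Ω (Fin d × Fin d) ⊤),
    MemLp U 1 (timeMeasure T) ∧ MemLp G 1 (timeMeasure T) ∧
    ∀ᵐ t ∂timeMeasure T,
      ((w t : L2 Ω) : Vec d → Vec d) =ᵐ[volume.restrict Ω] U t ∧ IsWeakGrad Ω (U t) (G t)

/-- `w ∈ L²(0,T; H²(Ω))`. -/
def MemL2H2 {d : ℕ} {Ω : Set (Vec d)} (T : ℝ) (w : ℝ → L2sigma Ω) : Prop :=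
  MemLp w 2 (timeMeasure T) ∧
  ∃ (G : ℝ → L2Mat Ω) (H : ℝ → LpOn Ω ((Fin d × Fin d) × Fin d) 2),
    MemLp G 2 (timeMeasure T) ∧ MemLp H 2 (timeMeasure T) ∧
    ∀ᵐ t ∂timeMeasure T, IsWeakGrad Ω (w t : L2 Ω) (G t) ∧ IsWeakGrad Ω (G t) (H t)

/-- `w ∈ H¹(0,T; L²_σ(Ω)^*)` with weak time derivative `w'`, where `L²_σ(Ω)^*` is identified with
`L²_σ(Ω)` by the Riesz isomorphism. -/
def HasL2TimeDeriv {d : ℕ} {Ω : Set (Vec d)} (T : ℝ) (w w' : ℝ → L2sigma Ω) : Prop :=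
  MemLp w 2 (timeMeasure T) ∧ MemLp w' 2 (timeMeasure T) ∧
  ∀ η : ℝ → ℝ, IsTest (Set.Ioo 0 T) η →
    ∫ t, deriv η t • w t ∂timeMeasure T = -∫ t, η t • w' t ∂timeMeasure T

/-- `w ∈ 𝕐` with time derivative `w'`: `w ∈ 𝕏 ∩ L¹(0,T; W^{1,∞}(Ω)) ∩ H¹(0,T; L²_σ(Ω)^*)` and,
if `ν > 0`, also `w ∈ L²(0,T; H²(Ω))`. -/
def MemY {d : ℕ} {Ω : Set (Vec d)} (ν T : ℝ) (w w' : ℝ → L2sigma Ω) : Prop :=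
  MemX ν T w ∧ MemL1W1inf T w ∧ HasL2TimeDeriv T w w' ∧ (0 < ν → MemL2H2 T w)

/-- A force `f = f₁ + f₂` with `f₁(t) ∈ H^{-1}(Ω) = H¹_0(Ω)^*` and `f₂(t) ∈ L²(Ω)`. -/
structure Force {d : ℕ} (Ω : Set (Vec d)) where
  /-- the part with values in `H^{-1}(Ω)` -/
  f₁ : ℝ → StrongDual ℝ (H10 Ω)
  /-- the part with values in `L²(Ω)` -/
  f₂ : ℝ → L2 Ω

/-- `f ∈ ℤ`: `f ∈ L²(0,T; H^{-1}(Ω)) + L¹(0,T; L²(Ω))` if `ν > 0`, and `f ∈ L¹(0,T; L²(Ω))`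
otherwise. -/
def MemZ {d : ℕ} {Ω : Set (Vec d)} (ν T : ℝ) (f : Force Ω) : Prop :=
  MemLp f.f₂ 1 (timeMeasure T) ∧ (0 < ν → MemLp f.f₁ 2 (timeMeasure T)) ∧
  (¬ 0 < ν → ∀ᵐ t ∂timeMeasure T, f.f₁ t = 0)

open Classical in
/-- The pairing `⟨f(t), u⟩ = ⟨f₁(t), u⟩ + (f₂(t), u)`; the first summand is read as `0` if
`u ∉ H¹_0(Ω)`, which matters only where `f₁ = 0`. -/
def Force.pairing {d : ℕ} {Ω : Set (Vec d)} (f : Force Ω) (t : ℝ) (u : L2 Ω) : ℝ :=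
  (if h : WithLp.toLp 2 (u, weakGrad u) ∈ H10 Ω then f.f₁ t ⟨_, h⟩ else 0) + inner ℝ (f.f₂ t) u

/-! ### The forms of the equation -/

/-- The relative energy `ℛ(u|w) = ½ ‖u - w‖²`. -/
def relEnergy {d : ℕ} {Ω : Set (Vec d)} (u w : L2sigma Ω) : ℝ := 1 / 2 * ‖u - w‖ ^ 2

/-- `((a · ∇) b, c)`. -/
def convForm {d : ℕ} {Ω : Set (Vec d)} (a b c : L2sigma Ω) : ℝ :=
  ∫ x in Ω, ∑ i, ∑ j, (a : L2 Ω) x j * weakGrad (b : L2 Ω) x (i, j) * (c : L2 Ω) x i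

/-- `(u ⊗ u ; ∇w)`. -/
def tensorForm {d : ℕ} {Ω : Set (Vec d)} (u w : L2sigma Ω) : ℝ :=
  ∫ x in Ω, ∑ i, ∑ j, (u : L2 Ω) x i * (u : L2 Ω) x j * weakGrad (w : L2 Ω) x (i, j)

/-- `∫_Ω uᵀ (∇w)_sym u`. -/
def symForm {d : ℕ} {Ω : Set (Vec d)} (u w : L2sigma Ω) : ℝ :=
  ∫ x in Ω, ∑ i, ∑ j, (u : L2 Ω) x i *
    (1 / 2 * (weakGrad (w : L2 Ω) x (i, j) + weakGrad (w : L2 Ω) x (j, i))) * (u : L2 Ω) x j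

/-- The relative form `𝒲_ν(u|w)` for the regularity measure `K`. -/
def relForm {d : ℕ} {Ω : Set (Vec d)} (ν : ℝ) (K : L2sigma Ω → ℝ≥0∞) (u w : L2sigma Ω) : ℝ :=
  if 0 < ν then
    ν * ‖weakGrad (u : L2 Ω) - weakGrad (w : L2 Ω)‖ ^ 2 - convForm (u - w) (u - w) w
      + (K w).toReal * relEnergy u w
  else
    symForm (u - w) w + (K w).toReal * relEnergy u w

/-- `⟨𝒜_ν(w), z⟩ = ⟨∂ₜw + (w·∇)w - νΔw - f, z⟩` at time `t`, in the weak sense in space;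
the argument after `w` stands for `∂ₜw`. -/
def sysOp {d : ℕ} {Ω : Set (Vec d)} (ν : ℝ) (f : Force Ω) (t : ℝ) (w w' z : L2sigma Ω) : ℝ :=
  inner ℝ w' z + convForm w w z + ν * inner ℝ (weakGrad (w : L2 Ω)) (weakGrad (z : L2 Ω))
    - f.pairing t z

/-! ### Regularity measures and solutions -/

/-- `𝒟(K) = {w ∈ 𝕏 | K(w) ∈ L¹(0,T)}`. -/
def domK {d : ℕ} {Ω : Set (Vec d)} (ν T : ℝ) (K : L2sigma Ω → ℝ≥0∞) : Set (ℝ → L2sigma Ω) :=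
  {w | MemX ν T w ∧ AEMeasurable (fun t => K (w t)) (timeMeasure T) ∧
    ∫⁻ t, K (w t) ∂timeMeasure T ≠ ⊤}

/-- `K` as a map from `𝒟(K)` to `L¹(0,T)`. -/
def mapK {d : ℕ} {Ω : Set (Vec d)} (ν T : ℝ) (K : L2sigma Ω → ℝ≥0∞) (w : domK ν T K) :
    Lp ℝ 1 (timeMeasure T) :=
  Integrable.toL1 (fun t => (K (w.1 t)).toReal)
    (integrable_toReal_of_lintegral_ne_top w.2.2.1 w.2.2.2)

/-- `w ∈ C¹([0,T]; C_{c,σ}^∞(Ω; ℝ^d))`. -/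
def IsC1Field {d : ℕ} {Ω : Set (Vec d)} (T : ℝ) (w : ℝ → L2sigma Ω) : Prop :=
  ∃ φ, IsC1Test Ω φ ∧ ∀ t ∈ Set.Icc 0 T, (w t : L2 Ω) =ᵐ[volume.restrict Ω] φ t

/-- Admissible regularity measures. -/
structure IsAdmissible {d : ℕ} {Ω : Set (Vec d)} (ν T : ℝ) (K : L2sigma Ω → ℝ≥0∞) : Prop where
  map_zero : K 0 = 0
  c1_mem : ∀ w : ℝ → L2sigma Ω, IsC1Field T w → w ∈ domK ν T K
  exists_topology : ∃ _ : TopologicalSpace (domK ν T K),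
    Continuous (mapK ν T K) ∧ Dense {w : domK ν T K | IsC1Field T w.1}
  relForm_nonneg : ∀ v w w' : ℝ → L2sigma Ω, MemX ν T v → MemY ν T w w' → w ∈ domK ν T K →
    ∀ᵐ t ∂timeMeasure T, 0 ≤ relForm ν K (v t) (w t)

/-- Energy-variational solutions `(v, ξ)` to the initial value `v₀` and the force `f`. The relative
energy inequality is required for almost all `s < t`. The version for all `s, t` with one-sided
limits `v(t+), ξ(t+), v(s-), ξ(s-)` contains this one, because functions with one-sided limits
are continuous up to a countable set. -/
structure IsEnergyVariationalSolution {d : ℕ} {Ω : Set (Vec d)} (ν T : ℝ) (f : Force Ω)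
    (v₀ : L2sigma Ω) (v : ℝ → L2sigma Ω) (ξ : ℝ → ℝ) : Prop where
  memX : MemX ν T v
  memLp_xi : MemLp ξ ⊤ (timeMeasure T)
  xi_nonneg : ∀ t ∈ Set.Ioo 0 T, 0 ≤ ξ t
  relative_energy : ∀ K : L2sigma Ω → ℝ≥0∞, IsAdmissible ν T K →
    ∀ w w' : ℝ → L2sigma Ω, MemY ν T w w' → w ∈ domK ν T K →
    ∀ᵐ s ∂timeMeasure T, ∀ᵐ t ∂timeMeasure T, s < t →
      relEnergy (v t) (w t) + ξ t
        + ∫ τ in s..t, (relForm ν K (v τ) (w τ) + sysOp ν f τ (w τ) (w' τ) (v τ - w τ)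
            - (K (w τ)).toReal * (relEnergy (v τ) (w τ) + ξ τ))
      ≤ relEnergy (v s) (w s) + ξ s
  /-- the initial value is attained weakly in `L²`, as an essential limit -/
  initial : ∀ z : L2sigma Ω,
    Tendsto (fun t => inner ℝ (v t) z) (𝓝[>] 0 ⊓ ae volume) (𝓝 (inner ℝ v₀ z))

/-- The total energy `½ ‖v(t)‖² + ξ(t)`. -/
def totalEnergy {d : ℕ} {Ω : Set (Vec d)} (v : ℝ → L2sigma Ω) (ξ : ℝ → ℝ) (t : ℝ) : ℝ :=
  1 / 2 * ‖v t‖ ^ 2 + ξ t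

/-- The integrand `ν ‖∇v‖² - ⟨f, v⟩` of the energy inequality. -/
def dissipation {d : ℕ} {Ω : Set (Vec d)} (ν : ℝ) (f : Force Ω) (v : ℝ → L2sigma Ω) (t : ℝ) : ℝ :=
  ν * ‖weakGrad (v t : L2 Ω)‖ ^ 2 - f.pairing t (v t)

/-- The integrand `ν (∇v, ∇w) - (v ⊗ v; ∇w) - (v, ∂ₜw) - ⟨f, w⟩` of the weak formulation, for the
test function `w` that is represented by the smooth field `φ`. -/
def residual {d : ℕ} {Ω : Set (Vec d)} (ν : ℝ) (f : Force Ω) (v : ℝ → L2sigma Ω)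
    (φ : ℝ → Vec d → Vec d) (w : ℝ → L2sigma Ω) (t : ℝ) : ℝ :=
  ν * inner ℝ (weakGrad (v t : L2 Ω)) (weakGrad (w t : L2 Ω)) - tensorForm (v t) (w t)
    - (∫ x in Ω, inner ℝ ((v t : L2 Ω) x) (deriv (fun τ => φ τ x) t)) - f.pairing t (w t)

end EVS

end

/-!
Test the relative energy inequality with a smooth solenoidal field `w`. Fields in `L²_σ(Ω)` are
orthogonal to gradients, and applying this to `∇(b · w)` (with `b ∈ H¹₀` approximated by smooth
fields) gives `((u · ∇)b, w) = -((u · ∇)w, b)`, so that the convective terms of `𝒲_ν` and `𝒜_ν` add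
up to `(v ⊗ v; ∇w)`. The terms `K(w) ℛ(v|w)` cancel, and the inequality becomes affine in `w` up to
the term `K(w) ξ`. For `w = 0` it is the energy inequality. Inserting `n w` for every integer `n`,
the homogeneity of `K` turns it into `c - n x - |n| y ≤ 0` with `x` the integral of the weak
formulation and `y` that of `K(w) ξ`; dividing by `|n|` and letting `n → ±∞` yields `|x| ≤ y`.
Only integers `n` are used because each `n` has its own null set of exceptional times.
-/

noncomputable section

namespace EVS

/-! ### Test functions and integration by parts -/

namespace IsTest

variable {X E F : Type*} [NormedAddCommGroup X] [NormedSpace ℝ X]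
  [NormedAddCommGroup E] [NormedSpace ℝ E] [NormedAddCommGroup F] [NormedSpace ℝ F]
  {U : Set X} {φ : X → E}

lemma contDiff_one (h : IsTest U φ) : ContDiff ℝ 1 φ := h.1.of_le (by simp)

lemma differentiable (h : IsTest U φ) : Differentiable ℝ φ :=
  h.contDiff_one.differentiable one_ne_zero

lemma fderiv (h : IsTest U φ) : IsTest U (fderiv ℝ φ) :=
  ⟨h.1.fderiv_right (by simp), h.2.1.fderiv ℝ, (tsupport_fderiv_subset ℝ).trans h.2.2⟩

lemma of_eq_zero_imp (h : IsTest U φ) {ψ : X → F} (hψ : ContDiff ℝ ∞ ψ)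
    (h0 : ∀ x, φ x = 0 → ψ x = 0) : IsTest U ψ := by
  have hsupp : Function.support ψ ⊆ Function.support φ := fun x => mt (h0 x)
  exact ⟨hψ, h.2.1.mono hsupp, (closure_mono hsupp).trans h.2.2⟩

lemma clm_comp (h : IsTest U φ) (L : E →L[ℝ] F) : IsTest U fun x => L (φ x) :=
  h.of_eq_zero_imp (L.contDiff.comp h.1) fun x hx => by rw [hx, map_zero]

lemma memLp [MeasurableSpace X] [OpensMeasurableSpace X] [SecondCountableTopologyEither X E]
    (h : IsTest U φ) (p : ℝ≥0∞) (μ : Measure X) [IsFiniteMeasureOnCompacts μ] : MemLp φ p μ :=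
  h.1.continuous.memLp_of_hasCompactSupport h.2.1

lemma setIntegral_mul_fderiv [FiniteDimensional ℝ X] [MeasurableSpace X] [BorelSpace X]
    {μ : Measure X} [μ.IsAddHaarMeasure] {f g : X → ℝ} (hf : IsTest U f) (hg : ContDiff ℝ 1 g)
    (e : X) : ∫ x in U, f x * _root_.fderiv ℝ g x e ∂μ =
      -∫ x in U, _root_.fderiv ℝ f x e * g x ∂μ := by
  have hf' : IsTest U fun x => _root_.fderiv ℝ f x e :=
    hf.fderiv.clm_comp (ContinuousLinearMap.apply ℝ ℝ e)
  have zero_of_notMem {h : X → ℝ} (hh : IsTest U h) (x : X) (hx : x ∉ U) : h x = 0 :=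
    image_eq_zero_of_notMem_tsupport fun hx' => hx (hh.2.2 hx')
  have integrable_mul {h k : X → ℝ} (hh : IsTest U h) (hk : Continuous k) :
      Integrable (fun x => h x * k x) μ :=
    (hh.1.continuous.mul hk).integrable_of_hasCompactSupport hh.2.1.mul_right
  have hg' : Continuous fun x => _root_.fderiv ℝ g x e :=
    (hg.continuous_fderiv one_ne_zero).clm_apply continuous_const
  rw [setIntegral_eq_integral_of_forall_compl_eq_zero fun x hx => by
      rw [zero_of_notMem hf x hx, zero_mul],
    setIntegral_eq_integral_of_forall_compl_eq_zero fun x hx => by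
      rw [zero_of_notMem hf' x hx, zero_mul]]
  exact integral_mul_fderiv_eq_neg_fderiv_mul_of_integrable (integrable_mul hf' hg.continuous)
    (integrable_mul hf hg') (integrable_mul hf hg.continuous) (fun x _ => hf.differentiable x)
    fun x _ => hg.differentiable one_ne_zero x

end IsTest

section Gradients

variable {d : ℕ} {Ω : Set (Vec d)} {ι : Type} [Fintype ι]

/-- The matrix of a linear map `ℝ^d → ℝ^ι`, as a continuous linear function of that map. -/
def toMat (d : ℕ) (ι : Type) [Fintype ι] :
    (Vec d →L[ℝ] EuclideanSpace ℝ ι) →L[ℝ] EuclideanSpace ℝ (ι × Fin d) :=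
  (EuclideanSpace.equiv (ι × Fin d) ℝ).symm.toContinuousLinearMap ∘L
    ContinuousLinearMap.pi fun p => EuclideanSpace.proj p.1 ∘L
      ContinuousLinearMap.apply ℝ _ (EuclideanSpace.single p.2 1)

/-- The classical gradient of a map with values in `ℝ^ι`; unlike `gradMat` it can be iterated. -/
def gradField (φ : Vec d → EuclideanSpace ℝ ι) (x : Vec d) : EuclideanSpace ℝ (ι × Fin d) :=
  toMat d ι (fderiv ℝ φ x)

lemma gradField_apply (φ : Vec d → EuclideanSpace ℝ ι) (x : Vec d) (p : ι × Fin d) :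
    gradField φ x p = fderiv ℝ φ x (EuclideanSpace.single p.2 1) p.1 := rfl

lemma gradMat_eq_gradField (φ : Vec d → Vec d) : gradMat φ = gradField φ := rfl

lemma IsTest.gradField {φ : Vec d → EuclideanSpace ℝ ι} (h : IsTest Ω φ) :
    IsTest Ω (gradField φ) :=
  h.fderiv.clm_comp (toMat d ι)

lemma IsTest.coord {φ : Vec d → EuclideanSpace ℝ ι} (h : IsTest Ω φ) (i : ι) :
    IsTest Ω fun x => φ x i :=
  h.clm_comp (EuclideanSpace.proj i)

lemma fderiv_coord {φ : Vec d → EuclideanSpace ℝ ι} (h : ContDiff ℝ 1 φ) (x : Vec d) (i : ι)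
    (e : Vec d) : fderiv ℝ (fun y => φ y i) x e = fderiv ℝ φ x e i :=
  congrArg (fun L : Vec d →L[ℝ] ℝ => L e) ((EuclideanSpace.proj (𝕜 := ℝ) i).hasFDerivAt.comp x
    (h.differentiable one_ne_zero x).hasFDerivAt).fderiv

lemma isWeakGrad_gradField {φ : Vec d → EuclideanSpace ℝ ι} (h : ContDiff ℝ 1 φ) :
    IsWeakGrad Ω φ (gradField φ) := by
  intro η hη i j
  have hi : ContDiff ℝ 1 fun x => φ x i := (EuclideanSpace.proj (𝕜 := ℝ) i).contDiff.comp h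
  have hparts := hη.setIntegral_mul_fderiv (μ := volume) hi (EuclideanSpace.single j 1)
  simp only [fderiv_coord h] at hparts
  simp only [gradField_apply, mul_comm _ (η _), mul_comm (φ _ i), hparts, neg_neg]

lemma IsWeakGrad.congr {u u' : Vec d → EuclideanSpace ℝ ι}
    {G G' : Vec d → EuclideanSpace ℝ (ι × Fin d)} (h : IsWeakGrad Ω u G)
    (hu : u =ᵐ[volume.restrict Ω] u') (hG : G =ᵐ[volume.restrict Ω] G') : IsWeakGrad Ω u' G' := by
  intro η hη i j
  have hu_int : ∫ x in Ω, u x i * fderiv ℝ η x (EuclideanSpace.single j 1) =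
      ∫ x in Ω, u' x i * fderiv ℝ η x (EuclideanSpace.single j 1) :=
    integral_congr_ae (hu.mono fun x hx => by simp only [hx])
  have hG_int : ∫ x in Ω, G x (i, j) * η x = ∫ x in Ω, G' x (i, j) * η x :=
    integral_congr_ae (hG.mono fun x hx => by simp only [hx])
  rw [← hu_int, ← hG_int, h η hη i j]

lemma IsWeakGrad.const_smul {u : Vec d → EuclideanSpace ℝ ι}
    {G : Vec d → EuclideanSpace ℝ (ι × Fin d)} (h : IsWeakGrad Ω u G) (α : ℝ) :
    IsWeakGrad Ω (α • u) (α • G) := by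
  intro η hη i j
  simp only [Pi.smul_apply, PiLp.smul_apply, smul_eq_mul, mul_assoc, integral_const_mul,
    h η hη i j, mul_neg]

lemma IsWeakGrad.ae_eq (hΩ : IsOpen Ω) {u : Vec d → EuclideanSpace ℝ ι}
    {G H : Vec d → EuclideanSpace ℝ (ι × Fin d)} (hG : IsWeakGrad Ω u G) (hH : IsWeakGrad Ω u H)
    (hGi : LocallyIntegrable G (volume.restrict Ω))
    (hHi : LocallyIntegrable H (volume.restrict Ω)) : G =ᵐ[volume.restrict Ω] H := by
  have coord_ae_eq : ∀ p, ∀ᵐ x ∂volume.restrict Ω, G x p = H x p := by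
    intro p
    have coord_locallyIntegrable {A : Vec d → EuclideanSpace ℝ (ι × Fin d)}
        (hA : LocallyIntegrable A (volume.restrict Ω)) :
        LocallyIntegrable (fun x => A x p) (volume.restrict Ω) := fun x =>
      let ⟨s, hs, hAs⟩ := hA x
      ⟨s, hs, (EuclideanSpace.proj (𝕜 := ℝ) p).integrable_comp hAs⟩
    have hGp := coord_locallyIntegrable hGi
    have hHp := coord_locallyIntegrable hHi
    have hsub := hΩ.ae_eq_zero_of_integral_contDiff_smul_eq_zero (μ := volume.restrict Ω)
      ((hGp.sub hHp).locallyIntegrableOn Ω) fun η hη hηc hηΩ => by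
        have hint := (hG η ⟨hη, hηc, hηΩ⟩ p.1 p.2).symm.trans (hH η ⟨hη, hηc, hηΩ⟩ p.1 p.2)
        simp only [Pi.sub_apply, smul_sub]
        rw [integral_sub (hGp.integrable_smul_left_of_hasCompactSupport hη.continuous hηc)
          (hHp.integrable_smul_left_of_hasCompactSupport hη.continuous hηc), sub_eq_zero]
        simpa only [smul_eq_mul, mul_comm (η _)] using neg_injective hint
    filter_upwards [hsub, ae_restrict_mem hΩ.measurableSet] with x hx hxΩ
    exact sub_eq_zero.1 (hx hxΩ)
  filter_upwards [ae_all_iff.2 coord_ae_eq] with x hx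
  exact PiLp.ext hx

lemma weakGrad_eq (hΩ : IsOpen Ω) {u : L2 Ω} {G : L2Mat Ω} (h : IsWeakGrad Ω u G) :
    weakGrad u = G := by
  have hex : ∃ G : L2Mat Ω, IsWeakGrad Ω u G := ⟨G, h⟩
  rw [weakGrad, dif_pos hex]
  exact Lp.ext (hex.choose_spec.ae_eq hΩ h ((Lp.memLp _).locallyIntegrable one_le_two)
    ((Lp.memLp _).locallyIntegrable one_le_two))

lemma weakGrad_smul (hΩ : IsOpen Ω) (α : ℝ) (u : L2 Ω) :
    weakGrad (α • u) = α • weakGrad u := by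
  have smul_mem {β : ℝ} {w : L2 Ω} {G : L2Mat Ω} (h : IsWeakGrad Ω w G) :
      IsWeakGrad Ω (β • w : L2 Ω) (β • G : L2Mat Ω) :=
    (h.const_smul β).congr (Lp.coeFn_smul β w).symm (Lp.coeFn_smul β G).symm
  by_cases hu : ∃ G : L2Mat Ω, IsWeakGrad Ω u G
  · obtain ⟨G, hG⟩ := hu
    rw [weakGrad_eq hΩ hG, weakGrad_eq hΩ (smul_mem hG)]
  rcases eq_or_ne α 0 with rfl | hα
  · have zero_mem : IsWeakGrad Ω (0 : L2 Ω) (0 : L2Mat Ω) := by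
      have h : IsWeakGrad Ω (0 : Vec d → Vec d) (0 : Vec d → Mat d) := fun η _ i j => by simp
      exact h.congr (Lp.coeFn_zero _ _ _).symm (Lp.coeFn_zero _ _ _).symm
    rw [zero_smul, zero_smul, weakGrad_eq hΩ zero_mem]
  · have hαu : ¬∃ G : L2Mat Ω, IsWeakGrad Ω (α • u : L2 Ω) G := fun ⟨G, hG⟩ =>
      hu ⟨α⁻¹ • G, by simpa only [inv_smul_smul₀ hα] using smul_mem (β := α⁻¹) hG⟩
    rw [weakGrad, weakGrad, dif_neg hu, dif_neg hαu, smul_zero]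

lemma weakGrad_eq_toLp (hΩ : IsOpen Ω) {φ : Vec d → Vec d} (hφ : IsTest Ω φ) {u : L2 Ω}
    (hu : u =ᵐ[volume.restrict Ω] φ) : weakGrad u = (hφ.gradField.memLp 2 _).toLp _ :=
  weakGrad_eq hΩ ((isWeakGrad_gradField hφ.contDiff_one).congr hu.symm
    (hφ.gradField.memLp 2 _).coeFn_toLp.symm)

lemma coeFn_weakGrad (hΩ : IsOpen Ω) {φ : Vec d → Vec d} (hφ : IsTest Ω φ) {u : L2 Ω}
    (hu : u =ᵐ[volume.restrict Ω] φ) : weakGrad u =ᵐ[volume.restrict Ω] gradMat φ := by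
  rw [weakGrad_eq_toLp hΩ hφ hu]
  exact (hφ.gradField.memLp 2 _).coeFn_toLp

end Gradients

/-! ### Density of smooth fields -/

section Density

variable {d : ℕ} {Ω : Set (Vec d)}

lemma inner_eq_zero_of_mem_L2sigma {z : L2 Ω}
    (h : ∀ (φ : Vec d → Vec d) (u : L2 Ω), IsSolTest Ω φ → u =ᵐ[volume.restrict Ω] φ →
      inner ℝ z u = 0) (u : L2sigma Ω) : inner ℝ z (u : L2 Ω) = 0 := by
  have : L2sigma Ω ≤ (Submodule.span ℝ {z})ᗮ := by
    refine Submodule.topologicalClosure_minimal _ (Submodule.span_le.2 ?_)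
      (Submodule.isClosed_orthogonal _)
    rintro w ⟨φ, hφ, hw⟩
    exact Submodule.mem_orthogonal_singleton_iff_inner_right.2 (h φ w hφ hw)
  exact Submodule.mem_orthogonal_singleton_iff_inner_right.1 (this u.2)

lemma inner_add_inner_eq_zero_of_mem_H1closure {A : Set (Vec d → Vec d)} {a : L2 Ω} {b : L2Mat Ω}
    (h : ∀ φ ∈ A, ∀ (u : L2 Ω) (G : L2Mat Ω), u =ᵐ[volume.restrict Ω] φ →
      G =ᵐ[volume.restrict Ω] gradMat φ → inner ℝ a u + inner ℝ b G = 0)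
    {u : L2 Ω} {G : L2Mat Ω} (hp : WithLp.toLp 2 (u, G) ∈ H1closure Ω A) :
    inner ℝ a u + inner ℝ b G = 0 := by
  have : H1closure Ω A ≤ (Submodule.span ℝ {WithLp.toLp 2 (a, b)})ᗮ := by
    refine Submodule.topologicalClosure_minimal _ (Submodule.span_le.2 ?_)
      (Submodule.isClosed_orthogonal _)
    rintro w ⟨φ, hφ, hw, hw'⟩
    refine Submodule.mem_orthogonal_singleton_iff_inner_right.2 ?_
    rw [WithLp.prod_inner_apply]
    exact h φ hφ _ _ hw hw'
  have := Submodule.mem_orthogonal_singleton_iff_inner_right.1 (this hp)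
  rwa [WithLp.prod_inner_apply] at this

lemma H10sigma_le_H10 : H10sigma Ω ≤ H10 Ω :=
  Submodule.topologicalClosure_mono (Submodule.span_mono fun _ ⟨φ, hφ, h⟩ => ⟨φ, hφ.1, h⟩)

lemma inner_eq_integral_sum {ι : Type} [Fintype ι] {a b : LpOn Ω ι 2}
    {f g : Vec d → EuclideanSpace ℝ ι} (hf : a =ᵐ[volume.restrict Ω] f)
    (hg : b =ᵐ[volume.restrict Ω] g) : inner ℝ a b = ∫ x in Ω, ∑ i, f x i * g x i := by
  rw [L2.inner_def]
  refine integral_congr_ae ?_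
  filter_upwards [hf, hg] with x hfx hgx
  simp only [hfx, hgx, PiLp.inner_apply, RCLike.inner_apply, conj_trivial, mul_comm]

lemma inner_toLp_smul_single {ι : Type} [Fintype ι] [DecidableEq ι] {c : Vec d → ℝ} {i : ι}
    (hc : MemLp (fun x => c x • EuclideanSpace.single i (1 : ℝ)) 2 (volume.restrict Ω))
    {u : LpOn Ω ι 2} {f : Vec d → EuclideanSpace ℝ ι} (hu : u =ᵐ[volume.restrict Ω] f) :
    inner ℝ (hc.toLp _) u = ∫ x in Ω, f x i * c x := by
  rw [inner_eq_integral_sum hc.coeFn_toLp hu]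
  simp [mul_comm]

lemma isWeakGrad_of_mem_H10 {u : L2 Ω} {G : L2Mat Ω} (hp : WithLp.toLp 2 (u, G) ∈ H10 Ω) :
    IsWeakGrad Ω u G := by
  intro η hη i j
  have hu' : MemLp (fun x => fderiv ℝ η x (EuclideanSpace.single j 1) •
      EuclideanSpace.single i (1 : ℝ)) 2 (volume.restrict Ω) :=
    (hη.fderiv.clm_comp ((ContinuousLinearMap.apply ℝ ℝ (EuclideanSpace.single j 1)).smulRight
      (EuclideanSpace.single i (1 : ℝ)))).memLp 2 _
  have hG' : MemLp (fun x => η x • EuclideanSpace.single (i, j) (1 : ℝ)) 2 (volume.restrict Ω) :=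
    (hη.clm_comp (ContinuousLinearMap.toSpanSingleton ℝ
      (EuclideanSpace.single (i, j) (1 : ℝ)))).memLp 2 _
  have horth := inner_add_inner_eq_zero_of_mem_H1closure (a := hu'.toLp _) (b := hG'.toLp _)
    (fun φ hφ u G hu hG => by
      rw [inner_toLp_smul_single hu' hu, inner_toLp_smul_single hG' hG,
        isWeakGrad_gradField (Ω := Ω) hφ.contDiff_one η hη i j, gradMat_eq_gradField,
        neg_add_cancel]) hp
  rw [inner_toLp_smul_single hu' (ae_eq_refl _), inner_toLp_smul_single hG' (ae_eq_refl _)]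
    at horth
  exact eq_neg_of_add_eq_zero_left horth

lemma weakGrad_eq_of_mem_H10 (hΩ : IsOpen Ω) {u : L2 Ω} {G : L2Mat Ω}
    (h : WithLp.toLp 2 (u, G) ∈ H10 Ω) : weakGrad u = G :=
  weakGrad_eq hΩ (isWeakGrad_of_mem_H10 h)

/-- `u ∈ H¹₀(Ω; ℝ^d)`, for `u ∈ L²(Ω; ℝ^d)`. -/
def MemH10 (u : L2 Ω) : Prop := WithLp.toLp 2 (u, weakGrad u) ∈ H10 Ω

/-- `u ∈ H¹₀(Ω; ℝ^d)` as the element `(u, ∇u)` of `H10 Ω`. -/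
def MemH10.toH10 {u : L2 Ω} (h : MemH10 u) : H10 Ω := ⟨WithLp.toLp 2 (u, weakGrad u), h⟩

lemma memH10_of_mem_H10 (hΩ : IsOpen Ω) {u : L2 Ω} {G : L2Mat Ω}
    (h : WithLp.toLp 2 (u, G) ∈ H10 Ω) : MemH10 u := by
  rwa [MemH10, weakGrad_eq_of_mem_H10 hΩ h]

lemma mem_H10sigma_of_isSolTest (hΩ : IsOpen Ω) {φ : Vec d → Vec d} (hφ : IsSolTest Ω φ)
    {u : L2 Ω} (hu : u =ᵐ[volume.restrict Ω] φ) :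
    WithLp.toLp 2 (u, weakGrad u) ∈ H10sigma Ω :=
  Submodule.le_topologicalClosure _
    (Submodule.subset_span ⟨φ, hφ, hu, coeFn_weakGrad hΩ hφ.1 hu⟩)

lemma IsSolTest.memH10 (hΩ : IsOpen Ω) {φ : Vec d → Vec d} (hφ : IsSolTest Ω φ)
    {u : L2 Ω} (hu : u =ᵐ[volume.restrict Ω] φ) : MemH10 u :=
  H10sigma_le_H10 (mem_H10sigma_of_isSolTest hΩ hφ hu)

lemma MemH10.sub_mem_H10 {u w : L2 Ω} (hu : MemH10 u) (hw : MemH10 w) :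
    WithLp.toLp 2 (u - w, weakGrad u - weakGrad w) ∈ H10 Ω :=
  (H10 Ω).sub_mem hu hw

lemma MemH10.sub (hΩ : IsOpen Ω) {u w : L2 Ω} (hu : MemH10 u) (hw : MemH10 w) :
    MemH10 (u - w) :=
  memH10_of_mem_H10 hΩ (hu.sub_mem_H10 hw)

lemma weakGrad_sub (hΩ : IsOpen Ω) {u w : L2 Ω} (hu : MemH10 u) (hw : MemH10 w) :
    weakGrad (u - w) = weakGrad u - weakGrad w :=
  weakGrad_eq_of_mem_H10 hΩ (hu.sub_mem_H10 hw)

lemma MemH10.toH10_sub (hΩ : IsOpen Ω) {u w : L2 Ω} (hu : MemH10 u) (hw : MemH10 w) :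
    (hu.sub hΩ hw).toH10 = hu.toH10 - hw.toH10 :=
  Subtype.ext (congrArg (fun G => WithLp.toLp 2 (u - w, G)) (weakGrad_sub hΩ hu hw))

lemma memH10_zero (hΩ : IsOpen Ω) : MemH10 (0 : L2 Ω) :=
  memH10_of_mem_H10 (G := 0) hΩ (H10 Ω).zero_mem

lemma MemH10.const_smul (hΩ : IsOpen Ω) {u : L2 Ω} (hu : MemH10 u) (α : ℝ) : MemH10 (α • u) := by
  rw [MemH10, weakGrad_smul hΩ]
  exact (H10 Ω).smul_mem α hu

lemma MemH10.toH10_smul (hΩ : IsOpen Ω) {u : L2 Ω} (hu : MemH10 u) (α : ℝ) :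
    (hu.const_smul hΩ α).toH10 = α • hu.toH10 :=
  Subtype.ext (congrArg (fun G => WithLp.toLp 2 (α • u, G)) (weakGrad_smul hΩ α u))

/-! ### Solenoidal fields are orthogonal to gradients -/

lemma setIntegral_fderiv_apply_eq_neg {η : Vec d → ℝ} (hη : ContDiff ℝ 1 η) {φ : Vec d → Vec d}
    (hφ : IsTest Ω φ) :
    ∫ x in Ω, fderiv ℝ η x (φ x) = -∫ x in Ω, divergence φ x * η x := by
  have fderiv_eq_sum (x : Vec d) : fderiv ℝ η x (φ x) =
      ∑ j, φ x j * fderiv ℝ η x (EuclideanSpace.single j 1) := by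
    conv_lhs => rw [← (EuclideanSpace.basisFun (Fin d) ℝ).sum_repr (φ x), map_sum]
    simp
  have integrable_mul {h k : Vec d → ℝ} (hh : IsTest Ω h) (hk : Continuous k) :
      Integrable (fun x => h x * k x) (volume.restrict Ω) :=
    ((hh.1.continuous.mul hk).integrable_of_hasCompactSupport hh.2.1.mul_right).integrableOn
  have coord_deriv_isTest (j : Fin d) :
      IsTest Ω fun x => fderiv ℝ φ x (EuclideanSpace.single j 1) j :=
    hφ.fderiv.clm_comp (EuclideanSpace.proj j ∘L
      ContinuousLinearMap.apply ℝ (Vec d) (EuclideanSpace.single j 1))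
  simp only [fderiv_eq_sum, divergence, Finset.sum_mul]
  rw [integral_finsetSum _ fun j _ => integrable_mul (hφ.coord j)
      ((hη.continuous_fderiv one_ne_zero).clm_apply continuous_const),
    integral_finsetSum _ fun j _ => integrable_mul (coord_deriv_isTest j) hη.continuous,
    ← Finset.sum_neg_distrib]
  refine Finset.sum_congr rfl fun j _ => ?_
  simp only [(hφ.coord j).setIntegral_mul_fderiv hη, fderiv_coord hφ.contDiff_one]

lemma inner_eq_zero_of_ae_eq_gradient {η : Vec d → ℝ} (hη : ContDiff ℝ 1 η) {z : L2 Ω}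
    (hz : z =ᵐ[volume.restrict Ω] gradient η) (u : L2sigma Ω) : inner ℝ z (u : L2 Ω) = 0 := by
  refine inner_eq_zero_of_mem_L2sigma (fun φ w hφ hw => ?_) u
  calc inner ℝ z w = ∫ x in Ω, fderiv ℝ η x (φ x) := by
        rw [L2.inner_def]
        refine integral_congr_ae ?_
        filter_upwards [hz, hw] with x hzx hwx
        rw [hzx, hwx, inner_gradient_left]
    _ = 0 := by simp [setIntegral_fderiv_apply_eq_neg hη hφ.1, hφ.2]

end Density

/-! ### Integration by parts in the convective form -/

section Convection

variable {d : ℕ} {Ω : Set (Vec d)}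

/-- The matrix-vector product `A x`, as a continuous bilinear map. -/
def matVec (d : ℕ) : Mat d →L[ℝ] Vec d →L[ℝ] Vec d :=
  LinearMap.toContinuousBilinearMap <|
    LinearMap.mk₂ ℝ (fun (A : Mat d) (x : Vec d) =>
        (WithLp.toLp 2 fun i => ∑ j, A (i, j) * x j : Vec d))
      (fun A B x => by ext i; simp [add_mul, Finset.sum_add_distrib])
      (fun c A x => by ext i; simp [Finset.mul_sum, mul_assoc])
      (fun A x y => by ext i; simp [mul_add, Finset.sum_add_distrib])
      (fun c A x => by ext i; simp [Finset.mul_sum, mul_left_comm])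

/-- The outer product `x ⊗ y = x yᵀ` of two vectors, as a continuous bilinear map. -/
def outer (d : ℕ) : Vec d →L[ℝ] Vec d →L[ℝ] Mat d :=
  LinearMap.toContinuousBilinearMap <|
    LinearMap.mk₂ ℝ (fun (x y : Vec d) => (WithLp.toLp 2 fun p => x p.1 * y p.2 : Mat d))
      (fun x x' y => by ext i; simp [add_mul])
      (fun c x y => by ext i; simp [mul_assoc])
      (fun x y y' => by ext i; simp [mul_add])
      (fun c x y => by ext i; simp [mul_left_comm])

lemma matVec_apply (A : Mat d) (x : Vec d) (i : Fin d) :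
    matVec d A x i = ∑ j, A (i, j) * x j := rfl

lemma outer_apply (x y : Vec d) (p : Fin d × Fin d) : outer d x y p = x p.1 * y p.2 := rfl

lemma matVec_gradMat (φ : Vec d → Vec d) (x u : Vec d) :
    matVec d (gradMat φ x) u = fderiv ℝ φ x u := by
  conv_rhs => rw [← (EuclideanSpace.basisFun (Fin d) ℝ).sum_repr u, map_sum]
  ext i
  simp [matVec_apply, gradMat, mul_comm]

lemma inner_outer (x y : Vec d) (A : Mat d) :
    inner ℝ (outer d x y) A = inner ℝ x (matVec d A y) := by
  simp only [PiLp.inner_apply, outer_apply, matVec_apply, Fintype.sum_prod_type, Finset.sum_mul,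
    RCLike.inner_apply, conj_trivial]
  exact Finset.sum_congr rfl fun i _ => Finset.sum_congr rfl fun j _ => by ring

lemma inner_matVec_gradMat_add_inner_outer {φ ψ : Vec d → Vec d} {x : Vec d}
    (hφ : DifferentiableAt ℝ φ x) (hψ : DifferentiableAt ℝ ψ x) (u : Vec d) :
    inner ℝ (matVec d (gradMat φ x) u) (ψ x) + inner ℝ (outer d (φ x) u) (gradMat ψ x) =
      fderiv ℝ (fun y => inner ℝ (φ y) (ψ y)) x u := by
  rw [inner_outer, matVec_gradMat, matVec_gradMat, fderiv_inner_apply ℝ hφ hψ, add_comm]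

/-- The product of a bounded matrix field and an `L²` vector field. -/
def mulField : LpOn Ω (Fin d × Fin d) ⊤ →L[ℝ] L2 Ω →L[ℝ] L2 Ω :=
  (matVec d).holderL (volume.restrict Ω) ⊤ 2 2

/-- The outer product of a bounded vector field and an `L²` vector field. -/
def outerField : LpOn Ω (Fin d) ⊤ →L[ℝ] L2 Ω →L[ℝ] L2Mat Ω :=
  (outer d).holderL (volume.restrict Ω) ⊤ 2 2

lemma coeFn_mulField (g : LpOn Ω (Fin d × Fin d) ⊤) (a : L2 Ω) :
    mulField g a =ᵐ[volume.restrict Ω] fun x => matVec d (g x) (a x) :=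
  (matVec d).coeFn_holder g a

lemma coeFn_outerField (g : LpOn Ω (Fin d) ⊤) (a : L2 Ω) :
    outerField g a =ᵐ[volume.restrict Ω] fun x => outer d (g x) (a x) :=
  (outer d).coeFn_holder g a

lemma inner_mulField (g : LpOn Ω (Fin d × Fin d) ⊤) (a b : L2 Ω) :
    inner ℝ (mulField g a) b = ∫ x in Ω, ∑ i, ∑ j, a x j * g x (i, j) * b x i := by
  rw [inner_eq_integral_sum (coeFn_mulField g a) (ae_eq_refl _)]
  simp only [matVec_apply, Finset.sum_mul, mul_comm (g _ _)]

lemma inner_outerField (g : LpOn Ω (Fin d) ⊤) (a : L2 Ω) (b : L2Mat Ω) :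
    inner ℝ (outerField g a) b = ∫ x in Ω, ∑ i, ∑ j, a x j * b x (i, j) * g x i := by
  rw [inner_eq_integral_sum (coeFn_outerField g a) (ae_eq_refl _)]
  simp only [outer_apply, Fintype.sum_prod_type, mul_assoc, mul_comm (g _ _)]

lemma inner_mulField_add_inner_outerField {φ : Vec d → Vec d} (hφ : IsTest Ω φ)
    {U : LpOn Ω (Fin d) ⊤} {g : LpOn Ω (Fin d × Fin d) ⊤} (hU : U =ᵐ[volume.restrict Ω] φ)
    (hg : g =ᵐ[volume.restrict Ω] gradMat φ) (a : L2sigma Ω) {b : L2 Ω} (hb : MemH10 b) :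
    inner ℝ (mulField g (a : L2 Ω)) b + inner ℝ (outerField U (a : L2 Ω)) (weakGrad b) = 0 := by
  refine inner_add_inner_eq_zero_of_mem_H1closure (fun ψ hψ b B hb hB => ?_) hb
  let η : Vec d → ℝ := fun x => inner ℝ (φ x) (ψ x)
  have hη : IsTest Ω η := hφ.of_eq_zero_imp (hφ.1.inner ℝ hψ.1) fun x hx => by simp [η, hx]
  have hz : MemLp (gradient η) 2 (volume.restrict Ω) :=
    (hη.fderiv.clm_comp
      (InnerProductSpace.toDual ℝ (Vec d)).symm.toContinuousLinearEquiv.toContinuousLinearMap).memLp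
      2 _
  rw [← inner_eq_zero_of_ae_eq_gradient hη.contDiff_one hz.coeFn_toLp a, L2.inner_def, L2.inner_def,
    L2.inner_def, ← integral_add (L2.integrable_inner _ _) (L2.integrable_inner _ _)]
  refine integral_congr_ae ?_
  filter_upwards [hb, hB, hU, hg, coeFn_mulField g (a : L2 Ω), coeFn_outerField U (a : L2 Ω),
    hz.coeFn_toLp] with x hbx hBx hUx hgx hmul houter hzx
  rw [hmul, houter, hbx, hBx, hUx, hgx, hzx, inner_gradient_left]
  exact inner_matVec_gradMat_add_inner_outer (hφ.differentiable x) (hψ.differentiable x) _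

end Convection

/-! ### The forms of the equation at a fixed time -/

section Forms

variable {d : ℕ} {Ω : Set (Vec d)}

lemma tensorForm_eq_convForm (a w : L2sigma Ω) : tensorForm a w = convForm a w a := by
  simp only [tensorForm, convForm, mul_comm, mul_assoc]

lemma symForm_eq_tensorForm (a w : L2sigma Ω) : symForm a w = tensorForm a w := by
  refine integral_congr_ae (.of_forall fun x => ?_)
  have hswap : ∑ i, ∑ j, (a : L2 Ω) x i * (a : L2 Ω) x j * weakGrad (w : L2 Ω) x (j, i) =
      ∑ i, ∑ j, (a : L2 Ω) x i * (a : L2 Ω) x j * weakGrad (w : L2 Ω) x (i, j) := by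
    rw [Finset.sum_comm]
    simp only [mul_comm]
  calc _ = 1 / 2 * (∑ i, ∑ j, (a : L2 Ω) x i * (a : L2 Ω) x j * weakGrad (w : L2 Ω) x (i, j) +
        ∑ i, ∑ j, (a : L2 Ω) x i * (a : L2 Ω) x j * weakGrad (w : L2 Ω) x (j, i)) := by
        simp only [← Finset.sum_add_distrib, Finset.mul_sum]
        exact Finset.sum_congr rfl fun i _ => Finset.sum_congr rfl fun j _ => by ring
    _ = _ := by rw [hswap]; ring

lemma tensorForm_smul (hΩ : IsOpen Ω) (a : L2sigma Ω) (α : ℝ) (w : L2sigma Ω) :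
    tensorForm a (α • w) = α * tensorForm a w := by
  simp only [tensorForm, ← integral_const_mul]
  refine integral_congr_ae ?_
  rw [Submodule.coe_smul, weakGrad_smul hΩ]
  filter_upwards [Lp.coeFn_smul α (weakGrad (w : L2 Ω))] with x hx
  simp only [hx, Pi.smul_apply, PiLp.smul_apply, smul_eq_mul, Finset.mul_sum, mul_left_comm α]

section TestFunction

variable {φ : Vec d → Vec d} {w : L2sigma Ω}

lemma convForm_eq_inner_mulField (hΩ : IsOpen Ω) (hφ : IsTest Ω φ)
    (hw : (w : L2 Ω) =ᵐ[volume.restrict Ω] φ) {g : LpOn Ω (Fin d × Fin d) ⊤}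
    (hg : g =ᵐ[volume.restrict Ω] gradMat φ) (a c : L2sigma Ω) :
    convForm a w c = inner ℝ (mulField g (a : L2 Ω)) (c : L2 Ω) := by
  rw [inner_mulField, convForm]
  refine integral_congr_ae ?_
  filter_upwards [(coeFn_weakGrad hΩ hφ hw).trans hg.symm] with x hx
  rw [hx]

lemma convForm_sub_left (hΩ : IsOpen Ω) (hφ : IsTest Ω φ)
    (hw : (w : L2 Ω) =ᵐ[volume.restrict Ω] φ) (a b c : L2sigma Ω) :
    convForm (a - b) w c = convForm a w c - convForm b w c := by
  simp only [convForm_eq_inner_mulField hΩ hφ hw (hφ.gradField.memLp ⊤ _).coeFn_toLp,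
    Submodule.coe_sub, map_sub, inner_sub_left]

lemma convForm_sub_right (hΩ : IsOpen Ω) (hφ : IsTest Ω φ)
    (hw : (w : L2 Ω) =ᵐ[volume.restrict Ω] φ) (a b c : L2sigma Ω) :
    convForm a w (b - c) = convForm a w b - convForm a w c := by
  simp only [convForm_eq_inner_mulField hΩ hφ hw (hφ.gradField.memLp ⊤ _).coeFn_toLp,
    Submodule.coe_sub, inner_sub_right]

lemma convForm_swap (hΩ : IsOpen Ω) (hφ : IsTest Ω φ)
    (hw : (w : L2 Ω) =ᵐ[volume.restrict Ω] φ) (a : L2sigma Ω) {b : L2sigma Ω}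
    (hb : MemH10 (b : L2 Ω)) : convForm a b w = -convForm a w b := by
  have hU := (hφ.memLp ⊤ (volume.restrict Ω)).coeFn_toLp
  have hg := (hφ.gradField.memLp ⊤ (volume.restrict Ω)).coeFn_toLp
  have h_outer : convForm a b w =
      inner ℝ (outerField ((hφ.memLp ⊤ _).toLp φ) (a : L2 Ω)) (weakGrad (b : L2 Ω)) := by
    rw [inner_outerField, convForm]
    refine integral_congr_ae ?_
    filter_upwards [hw.trans hU.symm] with x hx
    rw [hx]
  rw [h_outer, convForm_eq_inner_mulField hΩ hφ hw hg]
  exact eq_neg_of_add_eq_zero_right (inner_mulField_add_inner_outerField hφ hU hg a hb)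

lemma convForm_self_eq_zero (hΩ : IsOpen Ω) (hφ : IsSolTest Ω φ)
    (hw : (w : L2 Ω) =ᵐ[volume.restrict Ω] φ) (a : L2sigma Ω) : convForm a w w = 0 :=
  self_eq_neg.1 (convForm_swap hΩ hφ.1 hw a (hφ.memH10 hΩ hw))

lemma tensorForm_sub_add_convForm (hΩ : IsOpen Ω) (hφ : IsSolTest Ω φ)
    (hw : (w : L2 Ω) =ᵐ[volume.restrict Ω] φ) (v : L2sigma Ω) :
    tensorForm (v - w) w + convForm w w (v - w) = tensorForm v w := by
  simp only [tensorForm_eq_convForm, convForm_sub_left hΩ hφ.1 hw, convForm_sub_right hΩ hφ.1 hw,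
    convForm_self_eq_zero hΩ hφ hw]
  ring

lemma relForm_eq (hΩ : IsOpen Ω) (hφ : IsSolTest Ω φ) (hw : (w : L2 Ω) =ᵐ[volume.restrict Ω] φ)
    {ν : ℝ} (hν : 0 ≤ ν) (K : L2sigma Ω → ℝ≥0∞) {v : L2sigma Ω}
    (hv : 0 < ν → MemH10 (v : L2 Ω)) :
    relForm ν K v w = ν * ‖weakGrad (v : L2 Ω) - weakGrad (w : L2 Ω)‖ ^ 2 +
      tensorForm (v - w) w + (K w).toReal * relEnergy v w := by
  rcases hν.lt_or_eq with hpos | rfl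
  · rw [relForm, if_pos hpos, convForm_swap hΩ hφ.1 hw _ ((hv hpos).sub hΩ (hφ.memH10 hΩ hw)),
      sub_neg_eq_add, tensorForm_eq_convForm]
  · rw [relForm, if_neg (lt_irrefl _), symForm_eq_tensorForm, zero_mul, zero_add]

end TestFunction

lemma viscous_identity (hΩ : IsOpen Ω) {ν : ℝ} (hν : 0 ≤ ν) {u w : L2 Ω} (hu : 0 < ν → MemH10 u)
    (hw : MemH10 w) :
    ν * ‖weakGrad u - weakGrad w‖ ^ 2 + ν * inner ℝ (weakGrad w) (weakGrad (u - w)) =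
      ν * ‖weakGrad u‖ ^ 2 - ν * inner ℝ (weakGrad u) (weakGrad w) := by
  rcases hν.lt_or_eq with hpos | rfl
  · rw [weakGrad_sub hΩ (hu hpos) hw, norm_sub_sq_real, inner_sub_right,
      real_inner_self_eq_norm_sq, real_inner_comm (weakGrad u) (weakGrad w)]
    ring
  · simp only [zero_mul, add_zero, sub_zero]

section Pairing

variable {f : Force Ω} {t : ℝ}

lemma pairing_of_memH10 {u : L2 Ω} (h : MemH10 u) :
    f.pairing t u = f.f₁ t h.toH10 + inner ℝ (f.f₂ t) u :=
  congrArg (· + inner ℝ (f.f₂ t) u) (dif_pos h)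

lemma pairing_of_not_memH10 {u : L2 Ω} (h : ¬MemH10 u) : f.pairing t u = inner ℝ (f.f₂ t) u :=
  (congrArg (· + inner ℝ (f.f₂ t) u) (dif_neg h)).trans (zero_add _)

lemma pairing_of_f₁_eq_zero (h : f.f₁ t = 0) (u : L2 Ω) : f.pairing t u = inner ℝ (f.f₂ t) u := by
  simp [Force.pairing, h]

lemma pairing_sub (hΩ : IsOpen Ω) {u w : L2 Ω} (hu : f.f₁ t = 0 ∨ MemH10 u) (hw : MemH10 w) :
    f.pairing t (u - w) = f.pairing t u - f.pairing t w := by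
  have h_inner : inner ℝ (f.f₂ t) (u - w) = inner ℝ (f.f₂ t) u - inner ℝ (f.f₂ t) w :=
    inner_sub_right _ _ _
  rcases hu with h | hu
  · simp only [pairing_of_f₁_eq_zero h, h_inner]
  · have h_dual : f.f₁ t (hu.sub hΩ hw).toH10 = f.f₁ t hu.toH10 - f.f₁ t hw.toH10 :=
      (congrArg (f.f₁ t) (hu.toH10_sub hΩ hw)).trans (map_sub (f.f₁ t) _ _)
    linear_combination pairing_of_memH10 (f := f) (t := t) (hu.sub hΩ hw) - pairing_of_memH10 hu
      + pairing_of_memH10 hw + h_dual + h_inner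

lemma pairing_zero (hΩ : IsOpen Ω) : f.pairing t (0 : L2 Ω) = 0 := by
  simpa only [sub_self] using pairing_sub (f := f) (t := t) hΩ (.inr (memH10_zero hΩ))
    (memH10_zero hΩ)

lemma pairing_smul (hΩ : IsOpen Ω) (α : ℝ) (u : L2 Ω) :
    f.pairing t (α • u) = α * f.pairing t u := by
  rcases eq_or_ne α 0 with rfl | hα
  · rw [zero_smul, zero_mul, pairing_zero hΩ]
  have h_inner : inner ℝ (f.f₂ t) (α • u) = α * inner ℝ (f.f₂ t) u := inner_smul_right _ _ _
  by_cases hu : MemH10 u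
  · have h_dual : f.f₁ t (hu.const_smul hΩ α).toH10 = α * f.f₁ t hu.toH10 :=
      (congrArg (f.f₁ t) (hu.toH10_smul hΩ α)).trans (map_smul (f.f₁ t) α _)
    linear_combination pairing_of_memH10 (f := f) (t := t) (hu.const_smul hΩ α)
      - α * pairing_of_memH10 hu + h_dual + h_inner
  · have hαu : ¬MemH10 (α • u) := fun h =>
      hu (by simpa only [inv_smul_smul₀ hα] using h.const_smul hΩ α⁻¹)
    rw [pairing_of_not_memH10 hu, pairing_of_not_memH10 hαu, h_inner]

end Pairing

lemma relForm_add_sysOp (hΩ : IsOpen Ω) {φ : Vec d → Vec d} {w : L2sigma Ω} (hφ : IsSolTest Ω φ)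
    (hw : (w : L2 Ω) =ᵐ[volume.restrict Ω] φ) {ν : ℝ} (hν : 0 ≤ ν) {f : Force Ω} {t : ℝ}
    {v : L2sigma Ω} (hv : 0 < ν → MemH10 (v : L2 Ω)) (hf : ¬0 < ν → f.f₁ t = 0)
    (K : L2sigma Ω → ℝ≥0∞) (w' : L2sigma Ω) (ξ : ℝ) :
    relForm ν K v w + sysOp ν f t w w' (v - w) - (K w).toReal * (relEnergy v w + ξ) =
      (ν * ‖weakGrad (v : L2 Ω)‖ ^ 2 - f.pairing t v)
        - (ν * inner ℝ (weakGrad (v : L2 Ω)) (weakGrad (w : L2 Ω)) - tensorForm v w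
          - inner ℝ v w' - f.pairing t w)
        - inner ℝ w' w - (K w).toReal * ξ := by
  have h_pairing : f.pairing t ((v - w : L2sigma Ω) : L2 Ω) = f.pairing t v - f.pairing t w :=
    pairing_sub hΩ ((em (0 < ν)).symm.imp hf hv) (hφ.memH10 hΩ hw)
  have h_conv := tensorForm_sub_add_convForm hΩ hφ hw v
  have h_visc : ν * ‖weakGrad (v : L2 Ω) - weakGrad (w : L2 Ω)‖ ^ 2 +
      ν * inner ℝ (weakGrad (w : L2 Ω)) (weakGrad ((v - w : L2sigma Ω) : L2 Ω)) =
        ν * ‖weakGrad (v : L2 Ω)‖ ^ 2 - ν * inner ℝ (weakGrad (v : L2 Ω)) (weakGrad (w : L2 Ω)) :=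
    viscous_identity hΩ hν hv (hφ.memH10 hΩ hw)
  rw [relForm_eq hΩ hφ hw hν K hv, sysOp, h_pairing, inner_sub_right, real_inner_comm v w']
  linear_combination h_conv + h_visc

lemma residual_smul (hΩ : IsOpen Ω) (ν : ℝ) (f : Force Ω) (v : ℝ → L2sigma Ω) (α : ℝ)
    (φ : ℝ → Vec d → Vec d) (w : ℝ → L2sigma Ω) (t : ℝ) :
    residual ν f v (α • φ) (α • w) t = α * residual ν f v φ w t := by
  simp only [residual, Pi.smul_apply, Submodule.coe_smul, weakGrad_smul hΩ, pairing_smul hΩ,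
    tensorForm_smul hΩ, deriv_fun_const_smul_field, inner_smul_right, integral_const_mul]
  ring

end Forms

/-! ### Curves in `L^p` given by jointly continuous functions -/

section LpBound

variable {X F : Type*} [MeasurableSpace X] {μ : Measure X} [NormedAddCommGroup F] {p : ℝ≥0∞}
  {C : Set X}

lemma norm_le_of_ae_eq_of_forall_norm_le (hC : μ C ≠ ⊤) {δ : X → F} (hδ : ∀ x ∉ C, δ x = 0)
    {M : ℝ} (hM : 0 ≤ M) (hδM : ∀ x, ‖δ x‖ ≤ M) {u : Lp F p μ} (hu : u =ᵐ[μ] δ) :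
    ‖u‖ ≤ μ.real C ^ p.toReal⁻¹ * M := by
  have hsupp : Function.support δ ⊆ C := fun x hx => by_contra fun hxC => hx (hδ x hxC)
  have hle : eLpNorm δ p μ ≤ μ C ^ p.toReal⁻¹ * ENNReal.ofReal M := by
    rw [← eLpNorm_restrict_eq_of_support_subset hsupp]
    simpa using eLpNorm_le_of_ae_bound (μ := μ.restrict C) (p := p) (.of_forall hδM)
  have hfin : μ C ^ p.toReal⁻¹ * ENNReal.ofReal M ≠ ⊤ :=
    ENNReal.mul_ne_top (ENNReal.rpow_ne_top_of_nonneg (by positivity) hC) ENNReal.ofReal_ne_top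
  rw [Lp.norm_def, eLpNorm_congr_ae hu]
  refine (ENNReal.toReal_mono hfin hle).trans_eq ?_
  rw [ENNReal.toReal_mul, ← ENNReal.toReal_rpow, ENNReal.toReal_ofReal hM, measureReal_def]

lemma isLittleO_of_forall_eventually_norm_le {α : Type*} {l : Filter α} (hC : μ C ≠ ⊤)
    {δ : α → X → F} (hδ : ∀ a, ∀ x ∉ C, δ a x = 0) {g : α → ℝ}
    (hδg : ∀ ε > 0, ∀ᶠ a in l, ∀ x, ‖δ a x‖ ≤ ε * ‖g a‖) {D : α → Lp F p μ}
    (hD : ∀ a, D a =ᵐ[μ] δ a) : D =o[l] g := by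
  refine Asymptotics.isLittleO_iff.2 fun c hc => ?_
  set κ := μ.real C ^ p.toReal⁻¹
  have : 0 ≤ κ := by positivity
  filter_upwards [hδg (c / (κ + 1)) (by positivity)] with a ha
  calc ‖D a‖ ≤ κ * (c / (κ + 1) * ‖g a‖) :=
        norm_le_of_ae_eq_of_forall_norm_le hC (hδ a) (by positivity) ha (hD a)
    _ = κ / (κ + 1) * (c * ‖g a‖) := by ring
    _ ≤ c * ‖g a‖ := mul_le_of_le_one_left (by positivity) (by
        rw [div_le_one (by positivity)]; linarith)

end LpBound

section CompactFamily

variable {X F : Type*} [TopologicalSpace X] [NormedAddCommGroup F]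

/-- A jointly continuous family of functions `ψ t` that vanish outside a common compact set `C`.
It represents a continuous curve in every `L^p`. -/
structure IsCompactFamily (C : Set X) (ψ : ℝ → X → F) : Prop where
  isCompact : IsCompact C
  continuous : Continuous fun p : ℝ × X => ψ p.1 p.2
  eq_zero : ∀ t, ∀ x ∉ C, ψ t x = 0

variable {C : Set X} {ψ ψ' : ℝ → X → F}

lemma IsCompactFamily.eventually_norm_sub_le (h : IsCompactFamily C ψ) (t : ℝ) {ε : ℝ}
    (hε : 0 < ε) : ∀ᶠ s in 𝓝 t, ∀ x, ‖ψ s x - ψ t x‖ ≤ ε := by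
  have near_on_compact : ∀ᶠ s in 𝓝 t, ∀ x ∈ C, ‖ψ s x - ψ t x‖ < ε := by
    refine h.isCompact.eventually_forall_of_forall_eventually fun x _ => ?_
    have hcont : Continuous fun p : ℝ × X => ‖ψ p.1 p.2 - ψ t p.2‖ :=
      (h.continuous.sub (h.continuous.comp (continuous_const.prodMk continuous_snd))).norm
    exact hcont.continuousAt.eventually_lt continuousAt_const (by simpa using hε)
  filter_upwards [near_on_compact] with s hs x
  by_cases hx : x ∈ C
  · exact (hs x hx).le
  · rw [h.eq_zero s x hx, h.eq_zero t x hx, sub_zero, norm_zero]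
    exact hε.le

section Normed

variable [NormedSpace ℝ F]

lemma IsCompactFamily.clm_comp {G : Type*} [NormedAddCommGroup G] [NormedSpace ℝ G]
    (h : IsCompactFamily C ψ) (L : F →L[ℝ] G) : IsCompactFamily C fun t x => L (ψ t x) :=
  ⟨h.isCompact, L.continuous.comp h.continuous, fun t x hx => by rw [h.eq_zero t x hx, map_zero]⟩

lemma IsCompactFamily.eventually_norm_sub_sub_smul_le (h' : IsCompactFamily C ψ')
    (hψ : ∀ t x, HasDerivAt (fun s => ψ s x) (ψ' t x) t) (t : ℝ) {ε : ℝ} (hε : 0 < ε) :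
    ∀ᶠ s in 𝓝 t, ∀ x, ‖ψ s x - ψ t x - (s - t) • ψ' t x‖ ≤ ε * ‖s - t‖ := by
  obtain ⟨δ, hδ, hball⟩ := Metric.eventually_nhds_iff_ball.1 (h'.eventually_norm_sub_le t hε)
  filter_upwards [Metric.ball_mem_nhds t hδ] with s hs x
  have hderiv (r : ℝ) : HasDerivAt (fun r => ψ r x - (r - t) • ψ' t x) (ψ' r x - ψ' t x) r := by
    exact ((hψ r x).sub (((hasDerivAt_id r).sub_const t).smul_const (ψ' t x))).congr_deriv
      (by rw [one_smul])
  have hmv := (convex_ball t δ).norm_image_sub_le_of_norm_hasDerivWithin_le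
    (fun r _ => (hderiv r).hasDerivWithinAt) (fun r hr => hball r hr x)
    (Metric.mem_ball_self hδ) hs
  simpa only [sub_self, zero_smul, sub_zero, sub_right_comm] using hmv

end Normed

section Lp

variable [MeasurableSpace X] {μ : Measure X} [IsFiniteMeasureOnCompacts μ] {p : ℝ≥0∞}
  [Fact (1 ≤ p)] {U : ℝ → Lp F p μ}

lemma IsCompactFamily.continuous_Lp (h : IsCompactFamily C ψ) (hU : ∀ t, U t =ᵐ[μ] ψ t) :
    Continuous U := by
  refine continuous_iff_continuousAt.2 fun t => tendsto_iff_norm_sub_tendsto_zero.2 ?_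
  refine ((Asymptotics.isLittleO_one_iff ℝ).1 (isLittleO_of_forall_eventually_norm_le
    (g := fun _ => 1) h.isCompact.measure_ne_top (δ := fun s x => ψ s x - ψ t x)
    (fun s x hx => ?_) (fun ε hε => ?_) fun s => ?_)).norm.trans_eq ?_
  · rw [h.eq_zero s x hx, h.eq_zero t x hx, sub_zero]
  · simpa using h.eventually_norm_sub_le t hε
  · exact (Lp.coeFn_sub _ _).trans ((hU s).sub (hU t))
  · simp

lemma IsCompactFamily.hasDerivAt_Lp [NormedSpace ℝ F] (h : IsCompactFamily C ψ)
    (h' : IsCompactFamily C ψ') (hψ : ∀ t x, HasDerivAt (fun s => ψ s x) (ψ' t x) t)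
    (hU : ∀ t, U t =ᵐ[μ] ψ t) {t : ℝ} {V : Lp F p μ} (hV : V =ᵐ[μ] ψ' t) : HasDerivAt U V t := by
  refine hasDerivAt_iff_isLittleO.2 (isLittleO_of_forall_eventually_norm_le
    h.isCompact.measure_ne_top (δ := fun s x => ψ s x - ψ t x - (s - t) • ψ' t x)
    (fun s x hx => ?_) (fun ε hε => h'.eventually_norm_sub_sub_smul_le hψ t hε) fun s => ?_)
  · simp only [h.eq_zero _ x hx, h'.eq_zero _ x hx, sub_zero, smul_zero]
  · exact (Lp.coeFn_sub _ _).trans (((Lp.coeFn_sub _ _).trans ((hU s).sub (hU t))).sub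
      ((Lp.coeFn_smul _ _).trans (hV.const_smul _)))

end Lp

end CompactFamily

/-! ### Smooth solenoidal test functions in time and space -/

lemma gradField_gradField {d : ℕ} {Ω : Set (Vec d)} {φ : Vec d → Vec d} (h : IsTest Ω φ) :
    gradField (gradField φ) = fun x =>
      toMat d (Fin d × Fin d) (toMat d (Fin d) ∘L fderiv ℝ (fderiv ℝ φ) x) :=
  funext fun x => congrArg (toMat d (Fin d × Fin d))
    ((toMat d (Fin d)).hasFDerivAt.comp x (h.fderiv.differentiable x).hasFDerivAt).fderiv

section C1Test

variable {d : ℕ} {Ω : Set (Vec d)} {φ : ℝ → Vec d → Vec d}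

namespace IsC1Test

lemma hasDerivAt (h : IsC1Test Ω φ) (t : ℝ) (x : Vec d) :
    HasDerivAt (fun s => φ s x) (deriv (fun s => φ s x) t) t :=
  (h.differentiable x t).hasDerivAt

lemma isSolTest (h : IsC1Test Ω φ) (t : ℝ) : IsSolTest Ω (φ t) :=
  let ⟨_, hC, hCΩ, h0⟩ := h.support
  ⟨⟨h.smooth t, .intro hC (h0 t),
    (closure_minimal (fun x (hx : φ t x ≠ 0) => by_contra fun hxC => hx (h0 t x hxC))
      hC.isClosed).trans hCΩ⟩,
    h.solenoidal t⟩

lemma memLp_deriv (h : IsC1Test Ω φ) (t : ℝ) (p : ℝ≥0∞) (μ : Measure (Vec d))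
    [IsFiniteMeasureOnCompacts μ] : MemLp (fun x => deriv (fun s => φ s x) t) p μ :=
  let ⟨_, hC, _, h0⟩ := h.support
  (h.smooth_deriv t).continuous.memLp_of_hasCompactSupport
    (.intro hC fun x hx => by simp [h0 _ x hx])

lemma continuous_uncurry (h : IsC1Test Ω φ) : Continuous fun p : ℝ × Vec d => φ p.1 p.2 := by
  simpa only [Function.comp_def, ContinuousMultilinearMap.apply_apply, iteratedFDeriv_zero_apply]
    using (ContinuousMultilinearMap.apply ℝ (fun _ : Fin 0 => Vec d) (Vec d) 0).continuous.comp
      (h.continuous 0)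

lemma continuous_deriv_uncurry (h : IsC1Test Ω φ) :
    Continuous fun p : ℝ × Vec d => deriv (fun s => φ s p.2) p.1 := by
  simpa only [Function.comp_def, ContinuousMultilinearMap.apply_apply, iteratedFDeriv_zero_apply]
    using (ContinuousMultilinearMap.apply ℝ (fun _ : Fin 0 => Vec d) (Vec d) 0).continuous.comp
      (h.continuous_deriv 0)

lemma continuous_fderiv (h : IsC1Test Ω φ) :
    Continuous fun p : ℝ × Vec d => fderiv ℝ (φ p.1) p.2 := by
  refine continuous_clm_apply.2 fun y => ?_
  simpa only [Function.comp_def, ContinuousMultilinearMap.apply_apply, iteratedFDeriv_one_apply]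
    using (ContinuousMultilinearMap.apply ℝ (fun _ : Fin 1 => Vec d) (Vec d) fun _ =>
      y).continuous.comp (h.continuous 1)

lemma continuous_fderiv_fderiv (h : IsC1Test Ω φ) :
    Continuous fun p : ℝ × Vec d => fderiv ℝ (fderiv ℝ (φ p.1)) p.2 := by
  refine continuous_clm_apply.2 fun y => continuous_clm_apply.2 fun z => ?_
  simpa only [Function.comp_def, ContinuousMultilinearMap.apply_apply, iteratedFDeriv_two_apply,
    Matrix.cons_val_zero, Matrix.cons_val_one]
    using (ContinuousMultilinearMap.apply ℝ (fun _ : Fin 2 => Vec d) (Vec d)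
      ![y, z]).continuous.comp (h.continuous 2)

lemma const_smul (h : IsC1Test Ω φ) (α : ℝ) : IsC1Test Ω (α • φ) := by
  have deriv_smul (t : ℝ) : (fun x => deriv (fun τ => (α • φ) τ x) t) =
      α • fun x => deriv (fun τ => φ τ x) t :=
    funext fun x => deriv_fun_const_smul α (h.differentiable x t)
  have iteratedFDeriv_smul (n : ℕ) {ψ : Vec d → Vec d} (hψ : ContDiff ℝ ∞ ψ) (x : Vec d) :
      iteratedFDeriv ℝ n (α • ψ) x = α • iteratedFDeriv ℝ n ψ x :=
    iteratedFDeriv_const_smul_apply (hψ.of_le (by exact_mod_cast le_top)).contDiffAt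
  refine ⟨?_, fun t => (h.smooth t).const_smul α, fun t x => ?_,
    fun x => (h.differentiable x).const_smul α, fun t => ?_, fun n => ?_, fun n => ?_⟩
  · obtain ⟨C, hC, hCΩ, h0⟩ := h.support
    exact ⟨C, hC, hCΩ, fun t x hx => by simp [h0 t x hx]⟩
  · have hdiff := (h.isSolTest t).1.differentiable x
    simpa [divergence, fderiv_const_smul hdiff, ← Finset.mul_sum] using
      Or.inr (a := α = 0) (h.solenoidal t x)
  · rw [deriv_smul]
    exact (h.smooth_deriv t).const_smul α
  · simp only [Pi.smul_apply α φ, iteratedFDeriv_smul n (h.smooth _)]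
    exact (h.continuous n).const_smul α
  · simp only [deriv_smul, iteratedFDeriv_smul n (h.smooth_deriv _)]
    exact (h.continuous_deriv n).const_smul α

end IsC1Test

lemma isC1Test_zero : IsC1Test Ω (0 : ℝ → Vec d → Vec d) where
  support := ⟨∅, isCompact_empty, Set.empty_subset _, fun _ _ _ => rfl⟩
  smooth _ := contDiff_const
  solenoidal _ _ := by simp [divergence]
  differentiable _ := differentiable_const _
  smooth_deriv _ := by simpa using contDiff_const
  continuous _ := by simpa [iteratedFDeriv_fun_zero] using continuous_const
  continuous_deriv _ := by simpa [iteratedFDeriv_fun_zero] using continuous_const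

namespace IsC1Test

variable {w : ℝ → L2sigma Ω}

lemma exists_isCompactFamily (h : IsC1Test Ω φ) : ∃ C, IsCompactFamily C φ ∧
    IsCompactFamily C (fun t x => deriv (fun s => φ s x) t) ∧
    IsCompactFamily C (fun t => gradField (φ t)) ∧
    IsCompactFamily C (fun t => gradField (gradField (φ t))) := by
  obtain ⟨C, hC, -, h0⟩ := h.support
  have fderiv_eq_zero {E : Type} [NormedAddCommGroup E] [NormedSpace ℝ E] {ψ : Vec d → E}
      (hψ : ∀ x ∉ C, ψ x = 0) (x : Vec d) (hx : x ∉ C) : fderiv ℝ ψ x = 0 := by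
    have hev : ψ =ᶠ[𝓝 x] 0 := by
      filter_upwards [hC.isClosed.isOpen_compl.mem_nhds hx] with y hy using hψ y hy
    rw [hev.fderiv_eq, fderiv_zero, Pi.zero_apply]
  have hD : IsCompactFamily C fun t => fderiv ℝ (φ t) :=
    ⟨hC, h.continuous_fderiv, fun t => fderiv_eq_zero (h0 t)⟩
  have hD2 : IsCompactFamily C fun t => fderiv ℝ (fderiv ℝ (φ t)) :=
    ⟨hC, h.continuous_fderiv_fderiv, fun t => fderiv_eq_zero (fderiv_eq_zero (h0 t))⟩
  have hD2' : IsCompactFamily C fun t x => toMat d (Fin d) ∘L fderiv ℝ (fderiv ℝ (φ t)) x :=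
    hD2.clm_comp (ContinuousLinearMap.compL ℝ (Vec d) (Vec d →L[ℝ] Vec d) (Mat d) (toMat d (Fin d)))
  refine ⟨C, ⟨hC, h.continuous_uncurry, h0⟩,
    ⟨hC, h.continuous_deriv_uncurry, fun t x hx => by simp [h0 _ x hx]⟩,
    hD.clm_comp (toMat d (Fin d)), ?_⟩
  simp only [gradField_gradField (h.isSolTest _).1]
  exact hD2'.clm_comp (toMat d (Fin d × Fin d))

lemma hasDerivAt_toLp (h : IsC1Test Ω φ) (hw : ∀ t, (w t : L2 Ω) =ᵐ[volume.restrict Ω] φ t)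
    (t : ℝ) : HasDerivAt (fun s => (w s : L2 Ω))
      ((h.memLp_deriv t 2 (volume.restrict Ω)).toLp _) t :=
  let ⟨_, hφ, hφ', _⟩ := h.exists_isCompactFamily
  hφ.hasDerivAt_Lp hφ' h.hasDerivAt hw (MemLp.coeFn_toLp _)

lemma differentiable_L2sigma (h : IsC1Test Ω φ)
    (hw : ∀ t, (w t : L2 Ω) =ᵐ[volume.restrict Ω] φ t) : Differentiable ℝ w := by
  intro t
  have hder := h.hasDerivAt_toLp hw t
  have hmem : (h.memLp_deriv t 2 (volume.restrict Ω)).toLp _ ∈ L2sigma Ω :=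
    (Submodule.isClosed_topologicalClosure _ : IsClosed (L2sigma Ω : Set (L2 Ω))).mem_of_tendsto
      hder.tendsto_slope (.of_forall fun s => (L2sigma Ω).smul_mem _
        ((L2sigma Ω).sub_mem (w s).2 (w t).2))
  have hder' : HasDerivAt w ⟨_, hmem⟩ t := by
    rw [hasDerivAt_iff_isLittleO, ← Asymptotics.isLittleO_norm_left] at hder ⊢
    exact hder
  exact hder'.differentiableAt

lemma coe_deriv_eq (h : IsC1Test Ω φ) (hw : ∀ t, (w t : L2 Ω) =ᵐ[volume.restrict Ω] φ t) (t : ℝ) :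
    ((deriv w t : L2sigma Ω) : L2 Ω) = (h.memLp_deriv t 2 (volume.restrict Ω)).toLp _ :=
  ((L2sigma Ω).subtypeL.hasFDerivAt.comp_hasDerivAt t
    (h.differentiable_L2sigma hw t).hasDerivAt).unique (h.hasDerivAt_toLp hw t)

lemma coeFn_deriv (h : IsC1Test Ω φ) (hw : ∀ t, (w t : L2 Ω) =ᵐ[volume.restrict Ω] φ t) (t : ℝ) :
    ((deriv w t : L2sigma Ω) : L2 Ω) =ᵐ[volume.restrict Ω] fun x => deriv (fun s => φ s x) t := by
  rw [h.coe_deriv_eq hw]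
  exact MemLp.coeFn_toLp _

lemma continuous_deriv_L2sigma (h : IsC1Test Ω φ)
    (hw : ∀ t, (w t : L2 Ω) =ᵐ[volume.restrict Ω] φ t) : Continuous (deriv w) :=
  let ⟨_, _, hφ', _⟩ := h.exists_isCompactFamily
  continuous_induced_rng.2 (hφ'.continuous_Lp (h.coeFn_deriv hw))

lemma contDiff_L2sigma (h : IsC1Test Ω φ)
    (hw : ∀ t, (w t : L2 Ω) =ᵐ[volume.restrict Ω] φ t) : ContDiff ℝ 1 w :=
  contDiff_one_iff_deriv.2 ⟨h.differentiable_L2sigma hw, h.continuous_deriv_L2sigma hw⟩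

lemma continuous_toLp_gradField (h : IsC1Test Ω φ) (p : ℝ≥0∞) [Fact (1 ≤ p)] :
    Continuous fun t => ((h.isSolTest t).1.gradField.memLp p (volume.restrict Ω)).toLp _ :=
  let ⟨_, _, _, hφ, _⟩ := h.exists_isCompactFamily
  hφ.continuous_Lp fun _ => MemLp.coeFn_toLp _

lemma continuous_weakGrad (h : IsC1Test Ω φ) (hΩ : IsOpen Ω)
    (hw : ∀ t, (w t : L2 Ω) =ᵐ[volume.restrict Ω] φ t) :
    Continuous fun t => weakGrad (w t : L2 Ω) := by
  simpa only [weakGrad_eq_toLp hΩ (h.isSolTest _).1 (hw _)] using h.continuous_toLp_gradField 2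

end IsC1Test

/-! ### Smooth test functions belong to `𝕐` -/

instance isFiniteMeasure_timeMeasure (T : ℝ) : IsFiniteMeasure (timeMeasure T) :=
  inferInstanceAs (IsFiniteMeasure (volume.restrict (Set.Ioo 0 T)))

lemma memLp_timeMeasure_of_continuous {E : Type*} [NormedAddCommGroup E] {u : ℝ → E}
    (h : Continuous u) (p : ℝ≥0∞) (T : ℝ) : MemLp u p (timeMeasure T) := by
  obtain ⟨M, hM⟩ := (isCompact_Icc (a := 0) (b := T)).exists_bound_of_continuousOn h.continuousOn
  refine MemLp.of_bound h.aestronglyMeasurable M ?_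
  filter_upwards [ae_restrict_mem measurableSet_Ioo] with t ht
  exact hM t ⟨ht.1.le, ht.2.le⟩

lemma integral_timeMeasure_deriv_smul {E : Type*} [NormedAddCommGroup E] [NormedSpace ℝ E]
    [CompleteSpace E] {w : ℝ → E} (hw : ContDiff ℝ 1 w) {T : ℝ} {η : ℝ → ℝ}
    (hη : IsTest (Set.Ioo 0 T) η) :
    ∫ t, deriv η t • w t ∂timeMeasure T = -∫ t, η t • deriv w t ∂timeMeasure T := by
  have hη' : Continuous (deriv η) := hη.contDiff_one.continuous_deriv le_rfl
  have hw' : Continuous (deriv w) := hw.continuous_deriv le_rfl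
  have h_int : Integrable fun t => η t • w t :=
    (hη.1.continuous.smul hw.continuous).integrable_of_hasCompactSupport
    (μ := volume) hη.2.1.smul_right
  have h_int_left : Integrable fun t => deriv η t • w t :=
    (hη'.smul hw.continuous).integrable_of_hasCompactSupport
    (μ := volume) hη.2.1.deriv.smul_right
  have h_int_right : Integrable fun t => η t • deriv w t :=
    (hη.1.continuous.smul hw').integrable_of_hasCompactSupport
    (μ := volume) hη.2.1.smul_right
  have h_parts := integral_eq_zero_of_hasDerivAt_of_integrable
    (fun t => (hη.differentiable t).hasDerivAt.smul (hw.differentiable one_ne_zero t).hasDerivAt)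
    (h_int_right.add h_int_left) h_int
  rw [integral_add h_int_right h_int_left] at h_parts
  rw [timeMeasure, setIntegral_eq_integral_of_forall_compl_eq_zero fun t ht => ?_,
    setIntegral_eq_integral_of_forall_compl_eq_zero fun t ht => ?_]
  · exact eq_neg_of_add_eq_zero_right h_parts
  · rw [image_eq_zero_of_notMem_tsupport fun h => ht (hη.2.2 h), zero_smul]
  · rw [Function.notMem_support.1 fun h => ht (hη.2.2 (support_deriv_subset h)), zero_smul]

namespace IsC1Test

variable {w : ℝ → L2sigma Ω}

lemma memX (h : IsC1Test Ω φ) (hΩ : IsOpen Ω)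
    (hw : ∀ t, (w t : L2 Ω) =ᵐ[volume.restrict Ω] φ t) (ν T : ℝ) : MemX ν T w :=
  ⟨memLp_timeMeasure_of_continuous (h.differentiable_L2sigma hw).continuous ⊤ T, fun _ =>
    ⟨fun t => weakGrad (w t : L2 Ω),
      memLp_timeMeasure_of_continuous (h.continuous_weakGrad hΩ hw) 2 T,
      .of_forall fun t => mem_H10sigma_of_isSolTest hΩ (h.isSolTest t) (hw t)⟩⟩

lemma hasL2TimeDeriv (h : IsC1Test Ω φ) (hw : ∀ t, (w t : L2 Ω) =ᵐ[volume.restrict Ω] φ t)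
    (T : ℝ) : HasL2TimeDeriv T w (deriv w) := by
  have : CompleteSpace (L2sigma Ω) := Submodule.topologicalClosure.completeSpace _
  exact ⟨memLp_timeMeasure_of_continuous (h.differentiable_L2sigma hw).continuous 2 T,
    memLp_timeMeasure_of_continuous (h.continuous_deriv_L2sigma hw) 2 T, fun _ hη =>
    integral_timeMeasure_deriv_smul (h.contDiff_L2sigma hw) hη⟩

lemma memL1W1inf (h : IsC1Test Ω φ) (hw : ∀ t, (w t : L2 Ω) =ᵐ[volume.restrict Ω] φ t) (T : ℝ) :
    MemL1W1inf T w := by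
  obtain ⟨_, hφ, -⟩ := h.exists_isCompactFamily
  have hU (t : ℝ) := ((h.isSolTest t).1.memLp ⊤ (volume.restrict Ω)).coeFn_toLp
  refine ⟨_, _, memLp_timeMeasure_of_continuous (hφ.continuous_Lp hU) 1 T,
    memLp_timeMeasure_of_continuous (h.continuous_toLp_gradField ⊤) 1 T,
    .of_forall fun t => ⟨(hw t).trans (hU t).symm, ?_⟩⟩
  exact (isWeakGrad_gradField (h.isSolTest t).1.contDiff_one).congr (hU t).symm
    (MemLp.coeFn_toLp _).symm

lemma memL2H2 (h : IsC1Test Ω φ) (hΩ : IsOpen Ω)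
    (hw : ∀ t, (w t : L2 Ω) =ᵐ[volume.restrict Ω] φ t) (T : ℝ) : MemL2H2 T w := by
  obtain ⟨_, -, -, -, hD2⟩ := h.exists_isCompactFamily
  have hG (t : ℝ) := coeFn_weakGrad hΩ (h.isSolTest t).1 (hw t)
  have hH (t : ℝ) :=
    ((h.isSolTest t).1.gradField.gradField.memLp 2 (volume.restrict Ω)).coeFn_toLp
  refine ⟨memLp_timeMeasure_of_continuous (h.differentiable_L2sigma hw).continuous 2 T, _, _,
    memLp_timeMeasure_of_continuous (h.continuous_weakGrad hΩ hw) 2 T,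
    memLp_timeMeasure_of_continuous (hD2.continuous_Lp hH) 2 T, .of_forall fun t => ⟨?_, ?_⟩⟩
  · exact (isWeakGrad_gradField (h.isSolTest t).1.contDiff_one).congr (hw t).symm (hG t).symm
  · exact (isWeakGrad_gradField (h.isSolTest t).1.gradField.contDiff_one).congr (hG t).symm
      (hH t).symm

lemma memY (h : IsC1Test Ω φ) (hΩ : IsOpen Ω)
    (hw : ∀ t, (w t : L2 Ω) =ᵐ[volume.restrict Ω] φ t) (ν T : ℝ) : MemY ν T w (deriv w) :=
  ⟨h.memX hΩ hw ν T, h.memL1W1inf hw T, h.hasL2TimeDeriv hw T, fun _ => h.memL2H2 hΩ hw T⟩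

end IsC1Test

end C1Test

/-! ### Integrability in time -/

section Time

variable {d : ℕ} {Ω : Set (Vec d)} {ν T : ℝ} {f : Force Ω} {v w : ℝ → L2sigma Ω}

lemma intervalIntegrable_of_integrable_timeMeasure {u : ℝ → ℝ} (hu : Integrable u (timeMeasure T))
    {q r : ℝ} (hq : 0 ≤ q) (hqr : q ≤ r) (hr : r ≤ T) : IntervalIntegrable u volume q r :=
  (intervalIntegrable_iff_integrableOn_Ioo_of_le hqr).2
    (IntegrableOn.mono_set hu (Set.Ioo_subset_Ioo hq hr))

lemma ae_restrict_Ioo_of_ae_timeMeasure {P : ℝ → Prop} (h : ∀ᵐ t ∂timeMeasure T, P t) {a b : ℝ}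
    (ha : 0 ≤ a) (hb : b ≤ T) : ∀ᵐ t ∂volume.restrict (Set.Ioo a b), P t :=
  ae_restrict_of_ae_restrict_of_subset (Set.Ioo_subset_Ioo ha hb) h

lemma exists_mem_Ioo_of_ae_timeMeasure {P : ℝ → Prop} (h : ∀ᵐ t ∂timeMeasure T, P t) {a b : ℝ}
    (ha : 0 ≤ a) (hab : a < b) (hb : b ≤ T) : ∃ t ∈ Set.Ioo a b, P t := by
  have : (ae (volume.restrict (Set.Ioo a b))).NeBot := by
    rw [ae_restrict_neBot, Real.volume_Ioo]
    simpa using hab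
  exact ((ae_restrict_mem measurableSet_Ioo).and (ae_restrict_Ioo_of_ae_timeMeasure h ha hb)).exists

lemma integral_congr_of_ae_timeMeasure {u u' : ℝ → ℝ} (h : u =ᵐ[timeMeasure T] u') {q r : ℝ}
    (hq : 0 ≤ q) (hqr : q ≤ r) (hr : r ≤ T) : ∫ t in q..r, u t = ∫ t in q..r, u' t := by
  simp only [intervalIntegral.integral_of_le hqr, integral_Ioc_eq_integral_Ioo]
  exact integral_congr_ae (ae_restrict_Ioo_of_ae_timeMeasure h hq hr)

section Pairings

variable {α E : Type*} [MeasurableSpace α] {μ : Measure α} [NormedAddCommGroup E]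

lemma integrable_inner_of_memLp [InnerProductSpace ℝ E] {a b : α → E} {p q : ℝ≥0∞}
    [ENNReal.HolderTriple p q 1] (ha : MemLp a p μ) (hb : MemLp b q μ) :
    Integrable (fun t => (inner ℝ (a t) (b t) : ℝ)) μ :=
  memLp_one_iff_integrable.1 ((innerSL ℝ).memLp_of_bilin 1 ha hb)

lemma integrable_clm_apply [NormedSpace ℝ E] {L : α → StrongDual ℝ E} {z : α → E} {p q : ℝ≥0∞}
    [ENNReal.HolderTriple p q 1] (hL : MemLp L p μ) (hz : MemLp z q μ) :
    Integrable (fun t => L t (z t)) μ :=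
  memLp_one_iff_integrable.1
    ((ContinuousLinearMap.id ℝ (StrongDual ℝ E)).memLp_of_bilin (E := StrongDual ℝ E) 1 hL hz)

end Pairings

namespace MemX

lemma memLp_coe (h : MemX ν T v) (p : ℝ≥0∞) : MemLp (fun t => (v t : L2 Ω)) p (timeMeasure T) :=
  ((L2sigma Ω).subtypeL.comp_memLp' h.1).mono_exponent le_top

lemma ae_memH10 (h : MemX ν T v) (hΩ : IsOpen Ω) :
    ∀ᵐ t ∂timeMeasure T, 0 < ν → MemH10 (v t : L2 Ω) := by
  refine eventually_imp_distrib_left.2 fun hν => ?_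
  obtain ⟨G, -, hmem⟩ := h.2 hν
  filter_upwards [hmem] with t ht
  exact memH10_of_mem_H10 hΩ (H10sigma_le_H10 ht)

lemma memLp_weakGrad (h : MemX ν T v) (hΩ : IsOpen Ω) (hν : 0 < ν) :
    MemLp (fun t => weakGrad (v t : L2 Ω)) 2 (timeMeasure T) := by
  obtain ⟨G, hG, hmem⟩ := h.2 hν
  refine hG.ae_eq ?_
  filter_upwards [hmem] with t ht
  exact (weakGrad_eq_of_mem_H10 hΩ (H10sigma_le_H10 ht)).symm

end MemX

lemma integrable_pairing (hΩ : IsOpen Ω) (hf : MemZ ν T f) (hv : MemX ν T v) :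
    Integrable (fun t => f.pairing t (v t)) (timeMeasure T) := by
  have h_int₂ : Integrable (fun t => (inner ℝ (f.f₂ t) (v t : L2 Ω) : ℝ)) (timeMeasure T) :=
    integrable_inner_of_memLp (p := 1) (q := ⊤) hf.1 (hv.memLp_coe ⊤)
  by_cases hν : 0 < ν
  · have : CompleteSpace (H10 Ω) := Submodule.topologicalClosure.completeSpace _
    let P : ℝ → H10 Ω := fun t => (H10 Ω).orthogonalProjectionOnto
      (WithLp.toLp 2 ((v t : L2 Ω), weakGrad (v t : L2 Ω)))
    have hP : MemLp P 2 (timeMeasure T) := (H10 Ω).orthogonalProjectionOnto.comp_memLp'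
      (MemLp.of_fst_of_snd_prodLp ⟨hv.memLp_coe 2, hv.memLp_weakGrad hΩ hν⟩)
    refine ((integrable_clm_apply (hf.2.1 hν) hP).add h_int₂).congr ?_
    filter_upwards [hv.ae_memH10 hΩ] with t ht
    have hPt : P t = (ht hν).toH10 :=
      Submodule.orthogonalProjectionOnto_mem_subspace_eq_self (ht hν).toH10
    simp only [Pi.add_apply, hPt, pairing_of_memH10 (ht hν)]
  · refine h_int₂.congr ?_
    filter_upwards [hf.2.2 hν] with t ht
    exact (pairing_of_f₁_eq_zero ht _).symm

lemma integrable_dissipation (hΩ : IsOpen Ω) (hν : 0 ≤ ν) (hf : MemZ ν T f) (hv : MemX ν T v) :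
    Integrable (dissipation ν f v) (timeMeasure T) := by
  have h_visc : Integrable (fun t => ν * ‖weakGrad (v t : L2 Ω)‖ ^ 2) (timeMeasure T) := by
    rcases hν.eq_or_lt with rfl | hpos
    · simp
    · exact ((hv.memLp_weakGrad hΩ hpos).integrable_norm_pow two_ne_zero).const_mul ν
  exact h_visc.sub (integrable_pairing hΩ hf hv)

lemma integrable_toReal_mul {K : L2sigma Ω → ℝ≥0∞} (hw : w ∈ domK ν T K) {ξ : ℝ → ℝ}
    (hξ : MemLp ξ ⊤ (timeMeasure T)) :
    Integrable (fun t => (K (w t)).toReal * ξ t) (timeMeasure T) :=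
  memLp_one_iff_integrable.1 ((ContinuousLinearMap.mul ℝ ℝ).memLp_of_bilin 1
    (memLp_one_iff_integrable.2 (integrable_toReal_of_lintegral_ne_top hw.2.1 hw.2.2)) hξ)

namespace IsC1Test

variable {φ : ℝ → Vec d → Vec d}

lemma mem_domK (h : IsC1Test Ω φ) (hw : ∀ t, (w t : L2 Ω) =ᵐ[volume.restrict Ω] φ t)
    {K : L2sigma Ω → ℝ≥0∞} (hK : IsAdmissible ν T K) : w ∈ domK ν T K :=
  hK.c1_mem w ⟨φ, h, fun t _ => hw t⟩

lemma residual_eq (h : IsC1Test Ω φ) (hw : ∀ t, (w t : L2 Ω) =ᵐ[volume.restrict Ω] φ t) (ν : ℝ)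
    (f : Force Ω) (v : ℝ → L2sigma Ω) (t : ℝ) : residual ν f v φ w t =
      ν * inner ℝ (weakGrad (v t : L2 Ω)) (weakGrad (w t : L2 Ω)) - tensorForm (v t) (w t)
        - inner ℝ (v t) (deriv w t) - f.pairing t (w t) := by
  have h_deriv : ∫ x in Ω, inner ℝ ((v t : L2 Ω) x) (deriv (fun τ => φ τ x) t) =
      inner ℝ (v t) (deriv w t) := by
    rw [Submodule.coe_inner, L2.inner_def]
    refine integral_congr_ae ?_
    filter_upwards [h.coeFn_deriv hw t] with x hx
    rw [hx]
  rw [residual, h_deriv]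

lemma integrable_tensorForm (h : IsC1Test Ω φ)
    (hw : ∀ t, (w t : L2 Ω) =ᵐ[volume.restrict Ω] φ t) (hΩ : IsOpen Ω) (hv : MemX ν T v) :
    Integrable (fun t => tensorForm (v t) (w t)) (timeMeasure T) := by
  have h_mul : MemLp (fun t => mulField
      (((h.isSolTest t).1.gradField.memLp ⊤ (volume.restrict Ω)).toLp _) (v t : L2 Ω)) 2
      (timeMeasure T) :=
    mulField.memLp_of_bilin 2
      (memLp_timeMeasure_of_continuous (h.continuous_toLp_gradField ⊤) ⊤ T) (hv.memLp_coe 2)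
  simp only [tensorForm_eq_convForm, convForm_eq_inner_mulField hΩ (h.isSolTest _).1 (hw _)
    ((h.isSolTest _).1.gradField.memLp ⊤ (volume.restrict Ω)).coeFn_toLp]
  exact integrable_inner_of_memLp (p := 2) (q := 2) h_mul (hv.memLp_coe 2)

lemma integrable_residual (h : IsC1Test Ω φ) (hw : ∀ t, (w t : L2 Ω) =ᵐ[volume.restrict Ω] φ t)
    (hΩ : IsOpen Ω) (hν : 0 ≤ ν) (hf : MemZ ν T f) (hv : MemX ν T v) :
    Integrable (residual ν f v φ w) (timeMeasure T) := by
  have h_visc : Integrable (fun t => ν * inner ℝ (weakGrad (v t : L2 Ω)) (weakGrad (w t : L2 Ω)))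
      (timeMeasure T) := by
    rcases hν.eq_or_lt with rfl | hpos
    · simp
    · exact (integrable_inner_of_memLp (p := 2) (q := 2) (hv.memLp_weakGrad hΩ hpos)
        (memLp_timeMeasure_of_continuous (h.continuous_weakGrad hΩ hw) 2 T)).const_mul ν
  have h_deriv : Integrable (fun t => (inner ℝ (v t) (deriv w t) : ℝ)) (timeMeasure T) :=
    integrable_inner_of_memLp (p := ⊤) (q := 1) hv.1
      (memLp_timeMeasure_of_continuous (h.continuous_deriv_L2sigma hw) 1 T)
  refine (((h_visc.sub (h.integrable_tensorForm hw hΩ hv)).sub h_deriv).sub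
    (integrable_pairing hΩ hf (h.memX hΩ hw ν T))).congr (.of_forall fun t => ?_)
  exact (h.residual_eq hw ν f v t).symm

end IsC1Test

/-! ### The inequalities -/

section Inequalities

variable {v₀ : L2sigma Ω} {ξ : ℝ → ℝ} {K : L2sigma Ω → ℝ≥0∞} {φ : ℝ → Vec d → Vec d}

lemma relEnergy_eq (u w : L2sigma Ω) :
    relEnergy u w = 1 / 2 * ‖u‖ ^ 2 - inner ℝ u w + 1 / 2 * ‖w‖ ^ 2 := by
  rw [relEnergy, norm_sub_sq_real]
  ring

lemma integral_inner_deriv {E : Type*} [NormedAddCommGroup E] [InnerProductSpace ℝ E] {u : ℝ → E}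
    (hu : ContDiff ℝ 1 u) (q r : ℝ) :
    ∫ t in q..r, (inner ℝ (deriv u t) (u t) : ℝ) = 1 / 2 * ‖u r‖ ^ 2 - 1 / 2 * ‖u q‖ ^ 2 := by
  have hderiv (t : ℝ) : HasDerivAt (fun t => 1 / 2 * ‖u t‖ ^ 2) (inner ℝ (deriv u t) (u t)) t := by
    refine ((hu.differentiable one_ne_zero t).hasDerivAt.norm_sq.const_mul (1 / 2)).congr_deriv ?_
    rw [real_inner_comm]
    ring
  exact intervalIntegral.integral_eq_sub_of_hasDerivAt (fun t _ => hderiv t)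
    (((hu.continuous_deriv le_rfl).inner hu.continuous).intervalIntegrable q r)

namespace IsEnergyVariationalSolution

lemma ae_relForm_add_sysOp (hsol : IsEnergyVariationalSolution ν T f v₀ v ξ) (hΩ : IsOpen Ω)
    (hν : 0 ≤ ν) (hf : MemZ ν T f) (K : L2sigma Ω → ℝ≥0∞) (hφ : IsC1Test Ω φ)
    (hw : ∀ t, (w t : L2 Ω) =ᵐ[volume.restrict Ω] φ t) :
    (fun τ => relForm ν K (v τ) (w τ) + sysOp ν f τ (w τ) (deriv w τ) (v τ - w τ)
        - (K (w τ)).toReal * (relEnergy (v τ) (w τ) + ξ τ)) =ᵐ[timeMeasure T]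
      fun τ => dissipation ν f v τ - residual ν f v φ w τ - (K (w τ)).toReal * ξ τ
        - inner ℝ (deriv w τ) (w τ) := by
  have force_eq_zero : ∀ᵐ τ ∂timeMeasure T, ¬0 < ν → f.f₁ τ = 0 :=
    eventually_imp_distrib_left.2 hf.2.2
  filter_upwards [hsol.memX.ae_memH10 hΩ, force_eq_zero] with τ hvτ hfτ
  rw [hφ.residual_eq hw, dissipation,
    relForm_add_sysOp hΩ (hφ.isSolTest τ) (hw τ) hν hvτ hfτ K (deriv w τ) (ξ τ)]
  ring

lemma relative_energy_of_isC1Test (hsol : IsEnergyVariationalSolution ν T f v₀ v ξ)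
    (hΩ : IsOpen Ω) (hν : 0 ≤ ν) (hf : MemZ ν T f) (hK : IsAdmissible ν T K) (hφ : IsC1Test Ω φ)
    (hw : ∀ t, (w t : L2 Ω) =ᵐ[volume.restrict Ω] φ t) :
    ∀ᵐ q ∂timeMeasure T, ∀ᵐ r ∂timeMeasure T, q < r →
      totalEnergy v ξ r - inner ℝ (v r) (w r) + ((∫ τ in q..r, dissipation ν f v τ)
        - (∫ τ in q..r, residual ν f v φ w τ) - ∫ τ in q..r, (K (w τ)).toReal * ξ τ)
      ≤ totalEnergy v ξ q - inner ℝ (v q) (w q) := by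
  have hwC1 := hφ.contDiff_L2sigma hw
  filter_upwards [hsol.relative_energy K hK w (deriv w) (hφ.memY hΩ hw ν T) (hφ.mem_domK hw hK),
    ae_restrict_mem measurableSet_Ioo] with q hq hqT
  filter_upwards [hq, ae_restrict_mem measurableSet_Ioo] with r hr hrT hqr
  have intervalIntegrable {u : ℝ → ℝ} (hu : Integrable u (timeMeasure T)) :=
    intervalIntegrable_of_integrable_timeMeasure hu hqT.1.le hqr.le hrT.2.le
  have hD := intervalIntegrable (integrable_dissipation hΩ hν hf hsol.memX)
  have hR := intervalIntegrable (hφ.integrable_residual hw hΩ hν hf hsol.memX)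
  have hKξ := intervalIntegrable (integrable_toReal_mul (hφ.mem_domK hw hK) hsol.memLp_xi)
  have hww' : IntervalIntegrable (fun τ => (inner ℝ (deriv w τ) (w τ) : ℝ)) volume q r :=
    ((hwC1.continuous_deriv le_rfl).inner hwC1.continuous).intervalIntegrable q r
  have hineq := hr hqr
  rw [integral_congr_of_ae_timeMeasure (hsol.ae_relForm_add_sysOp hΩ hν hf K hφ hw) hqT.1.le
      hqr.le hrT.2.le, intervalIntegral.integral_sub ((hD.sub hR).sub hKξ) hww',
    intervalIntegral.integral_sub (hD.sub hR) hKξ, intervalIntegral.integral_sub hD hR,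
    integral_inner_deriv hwC1, relEnergy_eq, relEnergy_eq] at hineq
  rw [totalEnergy, totalEnergy]
  linarith

lemma energy_inequality (hsol : IsEnergyVariationalSolution ν T f v₀ v ξ) (hΩ : IsOpen Ω)
    (hν : 0 ≤ ν) (hf : MemZ ν T f) (hK : IsAdmissible ν T K) :
    ∀ᵐ q ∂timeMeasure T, ∀ᵐ r ∂timeMeasure T, q < r →
      totalEnergy v ξ r - totalEnergy v ξ q + ∫ τ in q..r, dissipation ν f v τ ≤ 0 := by
  have residual_zero : residual ν f v 0 0 = 0 := funext fun τ => by
    simpa using residual_smul hΩ ν f v 0 0 0 τ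
  filter_upwards [hsol.relative_energy_of_isC1Test hΩ hν hf hK isC1Test_zero (w := 0)
    fun _ => Lp.coeFn_zero _ _ _] with q hq
  filter_upwards [hq] with r hr hqr
  have hineq := hr hqr
  simp only [residual_zero, Pi.zero_apply, inner_zero_right, hK.map_zero, ENNReal.toReal_zero,
    zero_mul, intervalIntegral.integral_zero, sub_zero] at hineq
  linarith

end IsEnergyVariationalSolution

lemma abs_le_of_forall_int {c x y : ℝ} (h : ∀ n : ℤ, c - n * x - |(n : ℝ)| * y ≤ 0) : |x| ≤ y := by
  by_contra! hlt
  obtain ⟨n, hn⟩ := exists_nat_gt (-c / (|x| - y))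
  rw [div_lt_iff₀ (sub_pos.2 hlt)] at hn
  have h_pos := h n
  have h_neg := h (-n)
  push_cast at h_pos h_neg
  rw [Nat.abs_cast] at h_pos
  rw [abs_neg, Nat.abs_cast] at h_neg
  rcases abs_choice x with hx | hx <;> rw [hx] at hn <;> linarith

lemma IsEnergyVariationalSolution.abs_integral_residual_le
    (hsol : IsEnergyVariationalSolution ν T f v₀ v ξ) (hΩ : IsOpen Ω) (hν : 0 ≤ ν)
    (hf : MemZ ν T f) (hK : IsAdmissible ν T K)
    (hhom : ∀ (α : ℝ) (u : L2sigma Ω), K (α • u) = ENNReal.ofReal |α| * K u)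
    (hφ : IsC1Test Ω φ) (hw : ∀ t, (w t : L2 Ω) =ᵐ[volume.restrict Ω] φ t) :
    ∀ᵐ q ∂timeMeasure T, ∀ᵐ r ∂timeMeasure T, q < r → w q = 0 → w r = 0 →
      |∫ τ in q..r, residual ν f v φ w τ| ≤ ∫ τ in q..r, (K (w τ)).toReal * ξ τ := by
  have K_smul (α τ : ℝ) :
      (K ((α • w) τ)).toReal * ξ τ = |α| * ((K (w τ)).toReal * ξ τ) := by
    rw [Pi.smul_apply, hhom, ENNReal.toReal_mul, ENNReal.toReal_ofReal (abs_nonneg α), mul_assoc]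
  have hw_smul (α t : ℝ) : (((α • w) t : L2sigma Ω) : L2 Ω) =ᵐ[volume.restrict Ω] (α • φ) t :=
    (Lp.coeFn_smul α _).trans ((hw t).const_smul α)
  filter_upwards [ae_all_iff.2 fun n : ℤ => hsol.relative_energy_of_isC1Test hΩ hν hf hK
    (hφ.const_smul n) (hw_smul n)] with q hq
  filter_upwards [ae_all_iff.2 hq] with r hr hqr hwq hwr
  refine abs_le_of_forall_int (c := totalEnergy v ξ r - totalEnergy v ξ q
    + ∫ τ in q..r, dissipation ν f v τ) fun n => ?_
  have hineq := hr n hqr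
  simp only [residual_smul hΩ, K_smul, intervalIntegral.integral_const_mul] at hineq
  simp only [Pi.smul_apply, hwq, hwr, smul_zero, inner_zero_right, sub_zero] at hineq
  linarith

lemma eq_zero_of_ae_eq {ψ : Vec d → Vec d} (hψ : ∀ x, ψ x = 0) {u : L2sigma Ω}
    (hu : (u : L2 Ω) =ᵐ[volume.restrict Ω] ψ) : u = 0 := by
  obtain rfl : ψ = 0 := funext hψ
  exact Subtype.ext (Lp.ext (hu.trans (Lp.coeFn_zero _ _ _).symm))

lemma residual_eq_zero (hΩ : IsOpen Ω) {τ : ℝ} (hφ : ∀ᶠ σ in 𝓝 τ, ∀ x, φ σ x = 0) (hw : w τ = 0)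
    (ν : ℝ) (f : Force Ω) (v : ℝ → L2sigma Ω) : residual ν f v φ w τ = 0 := by
  have deriv_eq_zero (x : Vec d) : deriv (fun σ => φ σ x) τ = 0 := by
    have hx : (fun σ => φ σ x) =ᶠ[𝓝 τ] 0 := hφ.mono fun σ hσ => hσ x
    rw [hx.deriv_eq, Pi.zero_def, deriv_const]
  have weakGrad_zero : weakGrad (0 : L2 Ω) = 0 := by simpa using weakGrad_smul hΩ 0 (0 : L2 Ω)
  have tensorForm_zero : tensorForm (v τ) 0 = 0 := by simpa using tensorForm_smul hΩ (v τ) 0 0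
  simp only [residual, hw, deriv_eq_zero, tensorForm_zero, Submodule.coe_zero, weakGrad_zero,
    pairing_zero hΩ, inner_zero_right, integral_zero, mul_zero, sub_zero]

lemma integral_eq_of_support_subset_Icc {u : ℝ → ℝ} {a b q r q' r' : ℝ}
    (hu : Function.support u ⊆ Set.Icc a b) (hq : q < a) (hr : b ≤ r) (hq' : q' < a)
    (hr' : b ≤ r') : ∫ τ in q..r, u τ = ∫ τ in q'..r', u τ := by
  have Icc_subset {q r : ℝ} (hq : q < a) (hr : b ≤ r) : Set.Icc a b ⊆ Set.Ioc q r :=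
    fun τ hτ => ⟨hq.trans_le hτ.1, hτ.2.trans hr⟩
  rw [intervalIntegral.integral_eq_integral_of_support_subset (hu.trans (Icc_subset hq hr)),
    intervalIntegral.integral_eq_integral_of_support_subset (hu.trans (Icc_subset hq' hr'))]

lemma IsEnergyVariationalSolution.abs_integral_residual_le_of_isC1cTest
    (hsol : IsEnergyVariationalSolution ν T f v₀ v ξ) (hΩ : IsOpen Ω) (hν : 0 ≤ ν)
    (hf : MemZ ν T f) (hK : IsAdmissible ν T K)
    (hhom : ∀ (α : ℝ) (u : L2sigma Ω), K (α • u) = ENNReal.ofReal |α| * K u)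
    {s t : ℝ} (hs : 0 ≤ s) (ht : t ≤ T) (hφ : IsC1cTest Ω s t φ)
    (hw : ∀ τ, (w τ : L2 Ω) =ᵐ[volume.restrict Ω] φ τ) :
    |∫ τ in s..t, residual ν f v φ w τ| ≤ ∫ τ in s..t, (K (w τ)).toReal * ξ τ := by
  obtain ⟨hφ, a, b, hsa, hab, hbt, hφ0⟩ := hφ
  have w_eq_zero {τ : ℝ} (hτ : τ ∉ Set.Icc a b) : w τ = 0 :=
    eq_zero_of_ae_eq (hφ0 τ hτ) (hw τ)
  have support_residual : Function.support (residual ν f v φ w) ⊆ Set.Icc a b := fun τ hτ =>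
    by_contra fun hτab => hτ <| residual_eq_zero hΩ
      (eventually_of_mem (isClosed_Icc.isOpen_compl.mem_nhds hτab) hφ0) (w_eq_zero hτab) ν f v
  have support_K : (Function.support fun τ => (K (w τ)).toReal * ξ τ) ⊆ Set.Icc a b := fun τ hτ =>
    by_contra fun hτab => hτ (by
      simp only [w_eq_zero hτab, hK.map_zero, ENNReal.toReal_zero, zero_mul])
  obtain ⟨q, ⟨-, hqa⟩, hq⟩ := exists_mem_Ioo_of_ae_timeMeasure
    (hsol.abs_integral_residual_le hΩ hν hf hK hhom hφ hw) hs hsa (by linarith)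
  obtain ⟨r, ⟨hbr, -⟩, hqr⟩ := exists_mem_Ioo_of_ae_timeMeasure hq (by linarith) hbt ht
  rw [integral_eq_of_support_subset_Icc support_residual hsa hbt.le hqa hbr.le,
    integral_eq_of_support_subset_Icc support_K hsa hbt.le hqa hbr.le]
  exact hqr (hqa.trans_le (hab.trans hbr.le)) (w_eq_zero fun h => h.1.not_gt hqa)
    (w_eq_zero fun h => h.2.not_gt hbr)

end Inequalities

end Time

end EVS

end

open EVS in
theorem proposition2_general {d : ℕ} {Ω : Set (Vec d)} (hΩ : IsOpen Ω) {ν T : ℝ} (hν : 0 ≤ ν)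
    {f : Force Ω} (hf : MemZ ν T f) {v₀ : L2sigma Ω} {v : ℝ → L2sigma Ω} {ξ : ℝ → ℝ}
    (hsol : IsEnergyVariationalSolution ν T f v₀ v ξ) {K : L2sigma Ω → ℝ≥0∞}
    (hK : IsAdmissible ν T K)
    (hhom : ∀ (α : ℝ) (u : L2sigma Ω), K (α • u) = ENNReal.ofReal |α| * K u)
    {s t : ℝ} (hs : 0 ≤ s) (hst : s ≤ t) (ht : t ≤ T) :
    (IntervalIntegrable (dissipation ν f v) volume s t ∧
      ∀ᵐ q ∂volume.restrict (Set.Ioo s t), ∀ᵐ r ∂volume.restrict (Set.Ioo s t), q < r →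
        totalEnergy v ξ r - totalEnergy v ξ q + ∫ τ in q..r, dissipation ν f v τ ≤ 0) ∧
    ∀ (φ : ℝ → Vec d → Vec d) (w : ℝ → L2sigma Ω), IsC1cTest Ω s t φ →
      (∀ τ, (w τ : L2 Ω) =ᵐ[volume.restrict Ω] φ τ) →
      IntervalIntegrable (residual ν f v φ w) volume s t ∧
      IntervalIntegrable (fun τ => (K (w τ)).toReal * ξ τ) volume s t ∧
      (∫ τ in s..t, residual ν f v φ w τ) ∈
        Metric.closedBall (0 : ℝ) (∫ τ in s..t, (K (w τ)).toReal * ξ τ) := by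
  have intervalIntegrable {u : ℝ → ℝ} (hu : Integrable u (timeMeasure T)) :=
    intervalIntegrable_of_integrable_timeMeasure hu hs hst ht
  refine ⟨⟨intervalIntegrable (integrable_dissipation hΩ hν hf hsol.memX), ?_⟩, ?_⟩
  · filter_upwards [ae_restrict_Ioo_of_ae_timeMeasure (hsol.energy_inequality hΩ hν hf hK) hs ht]
      with q hq using ae_restrict_Ioo_of_ae_timeMeasure hq hs ht
  · intro φ w hφ hw
    refine ⟨intervalIntegrable (hφ.1.integrable_residual hw hΩ hν hf hsol.memX),
      intervalIntegrable (integrable_toReal_mul (hφ.1.mem_domK hw hK) hsol.memLp_xi), ?_⟩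
    rw [mem_closedBall_zero_iff, Real.norm_eq_abs]
    exact hsol.abs_integral_residual_le_of_isC1cTest hΩ hν hf hK hhom hs ht hφ hw

theorem proposition2 {d : ℕ} (hd : 2 ≤ d) (Ω : Set (EVS.Vec d))
    (hΩ : EVS.IsBoundedLipschitzDomain Ω) (ν T : ℝ) (hν : 0 ≤ ν) (hT : 0 < T)
    (f : EVS.Force Ω) (hf : EVS.MemZ ν T f) (v₀ : EVS.L2sigma Ω)
    (v : ℝ → EVS.L2sigma Ω) (ξ : ℝ → ℝ)
    (hsol : EVS.IsEnergyVariationalSolution ν T f v₀ v ξ)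
    (K : EVS.L2sigma Ω → ℝ≥0∞) (hK : EVS.IsAdmissible ν T K)
    (hhom : ∀ (α : ℝ) (u : EVS.L2sigma Ω), K (α • u) = ENNReal.ofReal |α| * K u)
    (s t : ℝ) (hs : 0 < s) (hst : s < t) (ht : t < T) :
    (IntervalIntegrable (EVS.dissipation ν f v) volume s t ∧
      ∀ᵐ q ∂volume.restrict (Set.Ioo s t), ∀ᵐ r ∂volume.restrict (Set.Ioo s t), q < r →
        EVS.totalEnergy v ξ r - EVS.totalEnergy v ξ q
          + ∫ τ in q..r, EVS.dissipation ν f v τ ≤ 0) ∧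
    ∀ (φ : ℝ → EVS.Vec d → EVS.Vec d) (w : ℝ → EVS.L2sigma Ω), EVS.IsC1cTest Ω s t φ →
      (∀ τ, (w τ : EVS.L2 Ω) =ᵐ[volume.restrict Ω] φ τ) → w ∈ EVS.domK ν T K →
      IntervalIntegrable (EVS.residual ν f v φ w) volume s t ∧
      IntervalIntegrable (fun τ => (K (w τ)).toReal * ξ τ) volume s t ∧
      (∫ τ in s..t, EVS.residual ν f v φ w τ) ∈
        Metric.closedBall (0 : ℝ) (∫ τ in s..t, (K (w τ)).toReal * ξ τ) := by
  have h := proposition2_general hΩ.isOpen hν hf hsol hK hhom hs.le hst.le ht.le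
  exact ⟨h.1, fun φ w hφ hw _ => h.2 φ w hφ hw⟩
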